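/- Let $\mathcal B\subseteq\mathbb N=\{1,2,\dots\}$ be non-empty, $\mathcal B\neq\{1\}$, and primitive, i.e. no element of $\mathcal B$ divides another one. **Notation.** For $\mathcal C\subseteq\mathbb N$ let $\mathcal M_{\mathcal C}=\bigcup_{c\in\mathcal C}c\mathbb Z$ and $\mathcal F_{\mathcal C}=\mathbb Z\setminus\mathcal M_{\mathcal C}$. The set $\mathcal B$ is *taut* if $\boldsymbol\delta(\mathcal M_{\mathcal B\setminus\{b\}})<\boldsymbol\delta(\mathcal M_{\mathcal B})$ for each $b\in\mathcal B$, where $\boldsymbol\delta(\mathcal M)=\lim_{n\to\infty}\frac1{\log n}\sum_{1\le k\le n,\,k\in\mathcal M}\frac1k$ is the logarithmic density (existence of these limits is part of the assertion that $\mathcal B$ is taut). Let $\Delta:\mathbb Z\to\prod_{b\in\mathcal B}\mathbb Z/b\mathbb Z$, $\Delta(n)=(n,n,\dots)$, where the product carries the product topology of the discrete topologies; let $H=\overline{\Delta(\mathbb Z)}$, let $R_{\Delta(1)}h=h+\Delta(1)$ be the rotation on $H$, and let $W=\{h\in H: h_b\ne 0\ \forall b\in\mathcal B\}$ be the window. Define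 $\varphi:H\to\{0,1\}^{\mathbb Z}$ by $\varphi(h)(n)=1$ if and only if $h+\Delta(n)\in W$. Let $\eta\in\{0,1\}^{\mathbb Z}$ be the characteristic function of $\mathcal F_{\mathcal B}$, and $X_\eta$ its orbit closure under the left shift $\sigma$; then $\eta=\varphi(0)$. A minimal set is a non-empty closed $\sigma$-invariant set containing no smaller such set; $X_\eta$ has a unique minimal subset, denoted $M$. For finite $S\subseteq\mathcal B$ let $\mathcal A_S=\{\gcd(b,\operatorname{lcm}(S)):b\in\mathcal B\}$ (with $\operatorname{lcm}(\emptyset)=1$), and let $\mathcal A_\infty$ be the set of $n\in\mathbb N$ such that for every finite $S\subseteq\mathcal B$ there is a finite $S'$ with $S\subseteq S'\subseteq\mathcal B$ and $n\in\mathcal A_{S'}\setminus S'$. A sequence $x\in\{0,1\}^{\mathbb Z}$ is *Toeplitz* if for every $n\in\mathbb Z$ there is $p\ge1$ with $x(n+jp)=x(n)$ for all $j\in\mathbb Z$. The system $(X_\eta,\sigma)$ is an *almost 1-1 extension* of $(H,R_{\Delta(1)})$ if there is a continuous surjection $\pi:X_\eta\to H$ with $\pi\circ\sigma=R_{\Delta(1)}\circ\pi$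 such that $\{x\in X_\eta:\pi^{-1}(\pi(x))=\{x\}\}$ is dense in $X_\eta$. **Theorem.** Consider the following properties. - (1) $W$ is topologically regular, i.e. $\overline{\operatorname{int}(W)}=W$ (in $H$). - (2) $\mathcal F_{\mathcal B}=\bigcup_{S\subseteq\mathcal B\text{ finite}}\mathcal F_{\mathcal A_S}$. - (3) $\mathcal A_\infty=\emptyset$. - (4) There are no $d\in\mathbb N$ and no infinite pairwise coprime set $\mathcal A\subseteq\mathbb N\setminus\{1\}$ such that $d\mathcal A\subseteq\mathcal B$. - (5) $\eta=\varphi(0)$ is a Toeplitz sequence different from $(\dots,0,0,0,\dots)$. - (6) $\varphi$ is continuous at $0\in H$, and $\varphi(0)\ne(\dots,0,0,0,\dots)$. - (7) $\eta\in M$ and $\eta\neq(\dots,0,0,0,\dots)$. - (8) $X_\eta$ is minimal, and $\operatorname{card}(X_\eta)>1$. - (9) $(X_\eta,\sigma)$ is minimal and is an almost 1-1 extension of $(H,R_{\Delta(1)})$. Then: a) (1)–(6) are all equivalent, and each of them implies that $\mathcal B$ is taut. b) (7) and (8) are equivalent. c) Each of (1)–(6) implies (9). d) (9) implies (7) and (8).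 e) If $\overline{\Delta(\mathbb Z)\cap W}=W$, then (1)–(9) are all equivalent. If $\mathcal B$ is taut, then $\overline{\Delta(\mathbb Z)\cap W}=W$. -/

import Mathlib

open Set Filter Topology

noncomputable section

namespace BFree

/-! ### Arithmetic of sets of multiples -/

/-- `B` is primitive: no element of `B` divides a different element of `B`. -/
def IsPrimitive (B : Set ℕ) : Prop :=
  ∀ b ∈ B, ∀ b' ∈ B, b ∣ b' → b = b'

/-- The set of multiples `⋃_{b ∈ B} bℤ`, as a set of integers. -/
def multiples (B : Set ℕ) : Set ℤ :=
  {n | ∃ b ∈ B, (b : ℤ) ∣ n}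

/-- The set of `B`-free integers. -/
def free (B : Set ℕ) : Set ℤ :=
  (multiples B)ᶜ

/-- The set `A ∩ {1, 2, …}` has logarithmic density `d`, that is,
`(1 / log n) ∑_{1 ≤ k ≤ n, k ∈ A} 1 / k → d`. -/
def HasLogDensity (A : Set ℤ) (d : ℝ) : Prop :=
  Tendsto
    (fun n : ℕ => (1 / Real.log n) *
      ∑ k ∈ Finset.Icc 1 n, A.indicator (fun m : ℤ => 1 / (m : ℝ)) (k : ℤ))
    atTop (𝓝 d)

/-- `B` is taut: for each `b ∈ B` the set of multiples of `B \ {b}` has a strictly smaller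
logarithmic density than the set of multiples of `B`. -/
def IsTaut (B : Set ℕ) : Prop :=
  ∀ b ∈ B, ∃ d d' : ℝ,
    HasLogDensity (multiples (B \ {b})) d ∧ HasLogDensity (multiples B) d' ∧ d < d'

/-- `A_S = {gcd(b, lcm(S)) : b ∈ B}`. -/
def gcdSet (B : Set ℕ) (S : Finset ℕ) : Set ℕ :=
  {a | ∃ b ∈ B, a = Nat.gcd b (S.lcm id)}

/-- `A_∞`: the positive integers `n` such that every finite `S ⊆ B` is contained in a finite
`S' ⊆ B` with `n ∈ A_{S'} \ S'`. -/
def gcdSetInf (B : Set ℕ) : Set ℕ :=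
  {n | 0 < n ∧ ∀ S : Finset ℕ, (S : Set ℕ) ⊆ B →
    ∃ S' : Finset ℕ, (S' : Set ℕ) ⊆ B ∧ S ⊆ S' ∧ n ∈ gcdSet B S' \ (S' : Set ℕ)}

/-! ### The group `H`, the window and the coding function -/

/-- The diagonal embedding `Δ : ℤ → ∏_{b ∈ B} ℤ/bℤ`. -/
def diag (B : Set ℕ) : ℤ →+ (∀ b : B, ZMod (b : ℕ)) where
  toFun n := fun _ => (n : ZMod _)
  map_zero' := by ext; simp
  map_add' m n := by ext; simp

/-- The group `H`, the closure of `Δ(ℤ)` in the product of the discrete groups `ℤ/bℤ`. -/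
def H (B : Set ℕ) : AddSubgroup (∀ b : B, ZMod (b : ℕ)) :=
  (diag B).range.topologicalClosure

/-- The diagonal embedding, as a map into `H`. -/
def Δ (B : Set ℕ) : ℤ →+ H B :=
  (diag B).codRestrict (H B) fun n =>
    AddSubgroup.le_topologicalClosure _ (AddMonoidHom.mem_range.2 ⟨n, rfl⟩)

/-- The window `W = {h ∈ H : h_b ≠ 0 for all b ∈ B}`. -/
def window (B : Set ℕ) : Set (H B) :=
  {h | ∀ b : B, (h : ∀ b : B, ZMod (b : ℕ)) b ≠ 0}

/-- The rotation of `H` by `Δ(1)`. -/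
def rotation (B : Set ℕ) (h : H B) : H B :=
  h + Δ B 1

open Classical in
/-- The coding function `φ : H → {0,1}^ℤ`: `φ(h)(n) = 1` if and only if the `n`-th iterate
`h + Δ(n)` of `h` under the rotation by `Δ(1)` lies in the window. -/
def coding (B : Set ℕ) (h : H B) : ℤ → Fin 2 :=
  fun n => if h + Δ B n ∈ window B then 1 else 0

open Classical in
/-- The sequence `η`, the characteristic function of the set of `B`-free integers. -/
def η (B : Set ℕ) : ℤ → Fin 2 :=
  fun n => if n ∈ free B then 1 else 0

/-! ### Subshifts of `{0,1}^ℤ` -/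

/-- The `n`-th power of the left shift on `{0,1}^ℤ`; the left shift itself is `shift 1`. -/
def shift (n : ℤ) (x : ℤ → Fin 2) : ℤ → Fin 2 :=
  fun m => x (m + n)

/-- The closure of the shift orbit of `x`. -/
def orbitClosure (x : ℤ → Fin 2) : Set (ℤ → Fin 2) :=
  closure (range fun n : ℤ => shift n x)

theorem continuous_shift (n : ℤ) : Continuous (shift n) :=
  continuous_pi fun m => continuous_apply (m + n)

theorem shift_mem_orbitClosure {x y : ℤ → Fin 2} (n : ℤ) (hy : y ∈ orbitClosure x) :
    shift n y ∈ orbitClosure x := by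
  refine map_mem_closure (continuous_shift n) hy ?_
  rintro _ ⟨k, rfl⟩
  refine ⟨n + k, ?_⟩
  funext m
  simp [shift, add_assoc]

/-- `X` is a minimal set of the shift: a non-empty closed invariant set which contains no
smaller non-empty closed invariant set. -/
def IsMinimalSet (X : Set (ℤ → Fin 2)) : Prop :=
  (X.Nonempty ∧ IsClosed X ∧ ∀ n : ℤ, MapsTo (shift n) X X) ∧
    ∀ N ⊆ X, N.Nonempty → IsClosed N → (∀ n : ℤ, MapsTo (shift n) N N) → N = X

/-- `x` is a Toeplitz sequence: every position lies in an arithmetic progression along which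
`x` is constant. -/
def IsToeplitz (x : ℤ → Fin 2) : Prop :=
  ∀ n : ℤ, ∃ p : ℕ, 0 < p ∧ ∀ j : ℤ, x (n + j * p) = x n

/-- The shift on the orbit closure `X_x` is an almost 1-1 extension of the rotation on `H`:
there is a continuous surjective equivariant map `π : X_x → H` such that the points of `X_x`
that are alone in their fibre of `π` are dense. -/
def IsAlmostOneOneExtension (B : Set ℕ) (x : ℤ → Fin 2) : Prop :=
  ∃ π : orbitClosure x → H B,
    Continuous π ∧ Function.Surjective π ∧
    (∀ y : orbitClosure x,
      π ⟨shift 1 y, shift_mem_orbitClosure 1 y.2⟩ = rotation B (π y)) ∧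
    Dense {y : orbitClosure x | ∀ z, π z = π y → z = y}

/-! ### The nine properties (`M` stands for the minimal subset of the orbit closure of `η`) -/

/-- The window is topologically regular. -/
def WindowRegular (B : Set ℕ) : Prop :=
  closure (interior (window B)) = window B

/-- The `B`-free integers are the union over finite `S ⊆ B` of the `A_S`-free integers. -/
def FreeEqUnion (B : Set ℕ) : Prop :=
  free B = {n | ∃ S : Finset ℕ, (S : Set ℕ) ⊆ B ∧ n ∈ free (gcdSet B S)}

/-- `A_∞` is empty. -/
def GcdSetInfEmpty (B : Set ℕ) : Prop :=
  gcdSetInf B = ∅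

/-- `B` contains no `d A` with `d ≥ 1` and `A ⊆ {2, 3, …}` infinite and pairwise coprime. -/
def NoCoprimeScaling (B : Set ℕ) : Prop :=
  ¬ ∃ (d : ℕ) (A : Set ℕ), 0 < d ∧ (∀ a ∈ A, 2 ≤ a) ∧ A.Infinite ∧
    A.Pairwise Nat.Coprime ∧ ∀ a ∈ A, d * a ∈ B

/-- `η` is a Toeplitz sequence different from the zero sequence. -/
def EtaToeplitz (B : Set ℕ) : Prop :=
  IsToeplitz (η B) ∧ η B ≠ 0

/-- `0` is a continuity point of `φ`, and `φ(0)` is not the zero sequence. -/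
def CodingContinuous (B : Set ℕ) : Prop :=
  ContinuousAt (coding B) 0 ∧ coding B 0 ≠ 0

/-- `η` lies in `M` and is not the zero sequence. -/
def EtaMemMinimal (B : Set ℕ) (M : Set (ℤ → Fin 2)) : Prop :=
  η B ∈ M ∧ η B ≠ 0

/-- The orbit closure of `η` is minimal and has more than one point. -/
def OrbitClosureMinimal (B : Set ℕ) : Prop :=
  IsMinimalSet (orbitClosure (η B)) ∧ (orbitClosure (η B)).Nontrivial

/-- The shift on the orbit closure of `η` is a minimal almost 1-1 extension of the rotation
by `Δ(1)` on `H`. -/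
def MinimalAlmostOneOne (B : Set ℕ) : Prop :=
  IsMinimalSet (orbitClosure (η B)) ∧ IsAlmostOneOneExtension B (η B)

end BFree

end

/-! The topology of `H` is read off the integers: Δ(ℤ) is dense, and by Bézout the cylinder with
coordinates in S around Δ(n) lies in W exactly when n is A_S-free (`cylinder_Δ_subset_window_iff`).
So (2) says that no Δ(n) lies on the boundary of W. This is continuity of φ at 0, and with periods
lcm(S) it is the Toeplitz property. The cycle is 1 → 4 → 3 → 2 → 1. If dA ⊆ B with A infinite and
pairwise coprime, every lcm(S) is coprime to some a ∈ A, so Δ(d) ∈ W is not in the closure of the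
interior: 1 → 4. An element of A_∞ yields such a set A greedily: 4 → 3. A free n ≠ 0 has finitely
many divisors, so if A_∞ is empty, one finite S excludes them all from A_S: 3 → 2.

The step 2 → 1 needs Δ(ℤ) ∩ W to be dense in W, which holds for taut B, and (4) implies taut
(`NoCoprimeScaling.isTaut`). The density rests on `IsTaut.exists_dvd_of_progression`. A progression
covered by multiples of B but not by those of a single b would make some {c : dc ∈ B} contain a
Behrend set, contradicting tautness. Splitting a Behrend set into finitely many pieces uses the
correlation inequality `hasLogDensity_mul_le`, from the four functions theorem. Passing from finite
to infinite sets uses the theorem of Davenport and Erdős, from Mertens' bound.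

For the dynamics, `IsCoded` is a closed relation between sequences and points of the compact group
`H`, so each point of X_η is coded by some h. By Baire some h₀ has an orbit off the boundary, and
φ(h₀) lies in the orbit closure of every coded sequence; it generates M. If W is regular and B taut,
W has no translational periods, so the coding point is unique and defines the factor map.
Conversely, if η ∈ M and Δ(ℤ) ∩ W is dense in W, some h translates W into the closure of its
interior, and suitable multiples of h return arbitrarily close to 0 (`windowRegular_of_η_mem`). -/

noncomputable section

namespace BFree

/-! ### Calculus of logarithmic densities -/

/-- The partial sums `∑_{1 ≤ k ≤ n, k ∈ A} 1 / k`. -/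
def logSum (A : Set ℤ) (n : ℕ) : ℝ :=
  ∑ k ∈ Finset.Icc 1 n, A.indicator (fun m : ℤ => 1 / (m : ℝ)) (k : ℤ)

theorem hasLogDensity_iff {A : Set ℤ} {d : ℝ} :
    HasLogDensity A d ↔ Tendsto (fun n : ℕ => logSum A n / Real.log n) atTop (𝓝 d) := by
  unfold HasLogDensity logSum
  simp only [one_div_mul_eq_div]

theorem indicator_one_div_nonneg (A : Set ℤ) (k : ℕ) :
    0 ≤ A.indicator (fun m : ℤ => 1 / (m : ℝ)) (k : ℤ) := by
  by_cases hk : (k : ℤ) ∈ A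
  · rw [indicator_of_mem hk]
    positivity
  · rw [indicator_of_notMem hk]

theorem logSum_nonneg (A : Set ℤ) (n : ℕ) : 0 ≤ logSum A n :=
  Finset.sum_nonneg fun k _ => indicator_one_div_nonneg A k

theorem logSum_succ (A : Set ℤ) (n : ℕ) :
    logSum A (n + 1) = logSum A n +
      A.indicator (fun m : ℤ => 1 / (m : ℝ)) ((n + 1 : ℕ) : ℤ) :=
  Finset.sum_Icc_succ_top (by omega) _

theorem logSum_le_add {A A₁ A₂ : Set ℤ} (h : A ⊆ A₁ ∪ A₂) (n : ℕ) :
    logSum A n ≤ logSum A₁ n + logSum A₂ n := by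
  unfold logSum
  rw [← Finset.sum_add_distrib]
  refine Finset.sum_le_sum fun k _ => ?_
  have h1 := indicator_one_div_nonneg A₁ k
  have h2 := indicator_one_div_nonneg A₂ k
  by_cases hk : (k : ℤ) ∈ A
  · rcases h hk with h' | h'
    · rw [indicator_of_mem hk, indicator_of_mem h'] at *
      linarith
    · rw [indicator_of_mem hk, indicator_of_mem h'] at *
      linarith
  · rw [indicator_of_notMem hk]
    linarith

theorem logSum_empty (n : ℕ) : logSum ∅ n = 0 := by
  simp [logSum]

theorem logSum_mono {A A' : Set ℤ} (h : A ⊆ A') (n : ℕ) : logSum A n ≤ logSum A' n := by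
  have := logSum_le_add (A₂ := ∅) (h.trans subset_union_left) n
  rwa [logSum_empty, add_zero] at this

theorem logSum_union {A A' : Set ℤ} (h : Disjoint A A') (n : ℕ) :
    logSum (A ∪ A') n = logSum A n + logSum A' n := by
  simp only [logSum, indicator_union_of_disjoint h, Finset.sum_add_distrib]

theorem log_le_logSum_univ (n : ℕ) : Real.log (n + 1) ≤ logSum univ n := by
  have := log_add_one_le_harmonic n
  rw [harmonic_eq_sum_Icc] at this
  simpa [logSum] using this

theorem logSum_univ_le (n : ℕ) : logSum univ n ≤ 1 + Real.log n := by
  have := harmonic_le_one_add_log n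
  rw [harmonic_eq_sum_Icc] at this
  simpa [logSum] using this

theorem tendsto_log_natCast : Tendsto (fun n : ℕ => Real.log n) atTop atTop :=
  Real.tendsto_log_atTop.comp tendsto_natCast_atTop_atTop

/-- A bounded error disappears after division by log n. Translation, dilation and periodicity all
reduce to this. -/
theorem HasLogDensity.of_abs_le {A A' : Set ℤ} {c d K : ℝ} (hA : HasLogDensity A d)
    (h : ∀ n, |logSum A' n - c * logSum A n| ≤ K) : HasLogDensity A' (c * d) := by
  rw [hasLogDensity_iff] at *
  have h0 : Tendsto (fun n : ℕ => (logSum A' n - c * logSum A n) / Real.log n) atTop (𝓝 0) := by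
    refine squeeze_zero_norm' (a := fun n : ℕ => K / Real.log n) ?_
      (tendsto_const_nhds.div_atTop tendsto_log_natCast)
    filter_upwards [eventually_gt_atTop 1] with n hn
    have : 0 < Real.log n := Real.log_pos (by exact_mod_cast hn)
    rw [Real.norm_eq_abs, abs_div, abs_of_pos this]
    gcongr
    exact h n
  have := h0.add (hA.const_mul c)
  rw [zero_add] at this
  refine this.congr fun n => ?_
  ring

theorem hasLogDensity_univ : HasLogDensity univ 1 := by
  rw [hasLogDensity_iff]
  refine tendsto_of_tendsto_of_tendsto_of_le_of_le' (g := fun _ => (1 : ℝ))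
    (h := fun n : ℕ => 1 / Real.log n + 1) tendsto_const_nhds ?_ ?_ ?_
  · have := (tendsto_const_nhds (x := (1 : ℝ))).div_atTop tendsto_log_natCast
    simpa using this.add_const (1 : ℝ)
  · filter_upwards [eventually_gt_atTop 1] with n hn
    have h1 : (1 : ℝ) < n := by exact_mod_cast hn
    have : 0 < Real.log n := Real.log_pos h1
    rw [le_div_iff₀ this, one_mul]
    exact (Real.log_le_log (by linarith) (by linarith)).trans (log_le_logSum_univ n)
  · filter_upwards [eventually_gt_atTop 1] with n hn
    have h1 : (1 : ℝ) < n := by exact_mod_cast hn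
    have : 0 < Real.log n := Real.log_pos h1
    rw [div_le_iff₀ this, add_mul, div_mul_cancel₀ _ this.ne', one_mul]
    exact logSum_univ_le n

theorem hasLogDensity_empty : HasLogDensity ∅ 0 := by
  rw [hasLogDensity_iff]
  simp [logSum_empty]

theorem HasLogDensity.unique {A : Set ℤ} {d d' : ℝ} (h : HasLogDensity A d)
    (h' : HasLogDensity A d') : d = d' :=
  tendsto_nhds_unique h h'

theorem HasLogDensity.le_of_eventually {A A' : Set ℤ} {d d' c : ℝ} (h : HasLogDensity A d)
    (h' : HasLogDensity A' d')
    (hle : ∀ᶠ n : ℕ in atTop, logSum A n ≤ logSum A' n + c * Real.log n) : d ≤ d' + c := by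
  rw [hasLogDensity_iff] at *
  refine le_of_tendsto_of_tendsto h (h'.add_const c) ?_
  filter_upwards [hle, eventually_gt_atTop 1] with n hn hn1
  have : 0 < Real.log n := Real.log_pos (by exact_mod_cast hn1)
  rw [div_le_iff₀ this, add_mul, div_mul_cancel₀ _ this.ne']
  exact hn

theorem HasLogDensity.mono {A A' : Set ℤ} {d d' : ℝ} (h : HasLogDensity A d)
    (h' : HasLogDensity A' d') (hs : A ⊆ A') : d ≤ d' := by
  have := h.le_of_eventually h' (c := 0) (Eventually.of_forall fun n => by simpa using logSum_mono hs n)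
  simpa using this

theorem HasLogDensity.nonneg {A : Set ℤ} {d : ℝ} (h : HasLogDensity A d) : 0 ≤ d :=
  hasLogDensity_empty.mono h (empty_subset A)

theorem HasLogDensity.union {A A' : Set ℤ} {d d' : ℝ} (h : HasLogDensity A d)
    (h' : HasLogDensity A' d') (hd : Disjoint A A') : HasLogDensity (A ∪ A') (d + d') := by
  rw [hasLogDensity_iff] at *
  refine (h.add h').congr fun n => ?_
  rw [logSum_union hd, add_div]

theorem HasLogDensity.diff {A A' : Set ℤ} {d d' : ℝ} (h : HasLogDensity A d)
    (h' : HasLogDensity A' d') (hs : A' ⊆ A) : HasLogDensity (A \ A') (d - d') := by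
  rw [hasLogDensity_iff] at *
  refine (h.sub h').congr fun n => ?_
  have := logSum_union (A := A \ A') (A' := A') disjoint_sdiff_left n
  rw [sdiff_union_of_subset hs] at this
  rw [this]
  ring

theorem HasLogDensity.compl {A : Set ℤ} {d : ℝ} (h : HasLogDensity A d) :
    HasLogDensity Aᶜ (1 - d) := by
  rw [compl_eq_univ_sdiff]
  exact hasLogDensity_univ.diff h (subset_univ _)

theorem HasLogDensity.le_add {A A₁ A₂ : Set ℤ} {d d₁ d₂ : ℝ} (h : HasLogDensity A d)
    (h₁ : HasLogDensity A₁ d₁) (h₂ : HasLogDensity A₂ d₂) (hs : A ⊆ A₁ ∪ A₂) : d ≤ d₁ + d₂ := by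
  rw [hasLogDensity_iff] at *
  refine le_of_tendsto_of_tendsto' h (h₁.add h₂) fun n => ?_
  rw [← add_div]
  have : 0 ≤ Real.log n := Real.log_natCast_nonneg n
  gcongr
  exact logSum_le_add hs n

theorem hasLogDensity_biUnion {ι : Type*} (s : Finset ι) (A : ι → Set ℤ) (d : ι → ℝ)
    (h : ∀ i ∈ s, HasLogDensity (A i) (d i)) (hd : (s : Set ι).PairwiseDisjoint A) :
    HasLogDensity (⋃ i ∈ s, A i) (∑ i ∈ s, d i) := by
  classical
  induction s using Finset.induction_on with
  | empty => simpa using hasLogDensity_empty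
  | insert i s hi ih =>
    rw [Finset.sum_insert hi, Finset.set_biUnion_insert]
    refine (h i (by simp)).union (ih (fun j hj => h j (by simp [hj]))
      (hd.subset (by simp))) ?_
    rw [disjoint_iUnion₂_right]
    intro j hj
    refine hd (by simp) (by simp [hj]) ?_
    rintro rfl
    exact hi hj

/-! ### Translations, dilations, periodic sets -/

theorem abs_logSum_shift_sub_le (A : Set ℤ) (n : ℕ) :
    |logSum {m | m + 1 ∈ A} n - 1 * logSum A n| ≤ 2 := by
  -- Moving a point from k + 1 to k raises its weight by at most 1/k - 1/(k+1), which telescopes to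
  -- 1 - 1/(n+1). Only the point 1 can drop out, at a cost of at most 1.
  have key : ∀ n, logSum A (n + 1) - 1 ≤ logSum {m | m + 1 ∈ A} n ∧
      logSum {m | m + 1 ∈ A} n ≤ logSum A (n + 1) + 1 - 1 / (n + 1) := by
    intro n
    induction n with
    | zero =>
      have h : logSum A 1 ≤ 1 := by simpa using (logSum_mono (subset_univ A) 1).trans (logSum_univ_le 1)
      have h' := logSum_nonneg A 1
      have h0 : logSum {m | m + 1 ∈ A} 0 = 0 := by simp [logSum]
      rw [h0]
      simp only [zero_add]
      norm_num
      exact ⟨h, h'⟩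
    | succ n ih =>
      rw [logSum_succ _ n, logSum_succ A (n + 1)]
      have h12 : (1 : ℝ) / (n + 1 + 1) ≤ 1 / (n + 1) := by
        gcongr
        linarith
      by_cases h : ((n + 1 + 1 : ℕ) : ℤ) ∈ A
      · have h' : ((n + 1 : ℕ) : ℤ) ∈ {m | m + 1 ∈ A} := by simpa using h
        rw [indicator_of_mem h, indicator_of_mem h']
        push_cast
        constructor <;> linarith [ih.1, ih.2]
      · have h' : ((n + 1 : ℕ) : ℤ) ∉ {m | m + 1 ∈ A} := by simpa using h
        rw [indicator_of_notMem h, indicator_of_notMem h']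
        push_cast
        constructor <;> linarith [ih.1, ih.2]
  obtain ⟨h1, h2⟩ := key n
  have h3 := logSum_succ A n
  have h4 := indicator_one_div_nonneg A (n + 1)
  have h5 : A.indicator (fun m : ℤ => 1 / (m : ℝ)) ((n + 1 : ℕ) : ℤ) ≤ 1 / (n + 1) := by
    by_cases hk : ((n + 1 : ℕ) : ℤ) ∈ A
    · rw [indicator_of_mem hk]
      push_cast
      rfl
    · rw [indicator_of_notMem hk]
      positivity
  have h6 : (1 : ℝ) / (n + 1) ≤ 1 := by
    rw [div_le_one (by positivity)]
    linarith [(Nat.cast_nonneg n : (0 : ℝ) ≤ n)]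
  have h7 : (0 : ℝ) ≤ 1 / (n + 1) := by positivity
  rw [abs_le]
  constructor <;> linarith

theorem HasLogDensity.shift_one {A : Set ℤ} {d : ℝ} (h : HasLogDensity A d) :
    HasLogDensity {m | m + 1 ∈ A} d := by
  simpa using h.of_abs_le (abs_logSum_shift_sub_le A)

theorem HasLogDensity.of_shift_one {A : Set ℤ} {d : ℝ} (h : HasLogDensity {m | m + 1 ∈ A} d) :
    HasLogDensity A d := by
  have := h.of_abs_le (A' := A) (c := 1) (K := 2) fun n => by
    have := abs_logSum_shift_sub_le A n
    rw [abs_sub_comm]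
    simpa using this
  simpa using this

theorem HasLogDensity.shift {A : Set ℤ} {d : ℝ} (h : HasLogDensity A d) (j : ℤ) :
    HasLogDensity {m | m + j ∈ A} d := by
  induction j using Int.induction_on with
  | zero => simpa using h
  | succ i ih =>
    have := ih.shift_one
    refine (congrArg (HasLogDensity · d) ?_).mp this
    ext m
    simp only [mem_ofPred_eq]
    rw [add_assoc, add_comm (1 : ℤ)]
  | pred i ih =>
    refine HasLogDensity.of_shift_one ?_
    refine (congrArg (HasLogDensity · d) ?_).mp ih
    ext m
    simp only [mem_ofPred_eq]
    rw [add_assoc]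
    congr! 2
    ring

theorem abs_logSum_shift_nat_sub_le (A : Set ℤ) (j n : ℕ) :
    |logSum {m | m + j ∈ A} n - logSum A n| ≤ 2 * j := by
  induction j with
  | zero => simp
  | succ j ih =>
    have := abs_logSum_shift_sub_le {m | m + j ∈ A} n
    have he : {m : ℤ | m + 1 ∈ {m | m + (j : ℤ) ∈ A}} = {m | m + ((j + 1 : ℕ) : ℤ) ∈ A} := by
      ext m
      simp only [mem_ofPred_eq]
      push_cast
      rw [add_assoc, add_comm (1 : ℤ)]
    rw [he] at this
    rw [abs_le] at *
    have hj : ((j + 1 : ℕ) : ℝ) = j + 1 := by push_cast; rfl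
    rw [hj]
    constructor <;> linarith [this.1, this.2, ih.1, ih.2]

/-- The set of multiples `n A`. -/
def dilate (n : ℕ) (A : Set ℤ) : Set ℤ :=
  {m | ∃ k ∈ A, m = n * k}

theorem mul_mem_dilate {n : ℕ} (hn : 0 < n) {A : Set ℤ} {k : ℤ} :
    (n : ℤ) * k ∈ dilate n A ↔ k ∈ A := by
  constructor
  · rintro ⟨k', hk', h⟩
    have : (n : ℤ) ≠ 0 := by exact_mod_cast hn.ne'
    rwa [mul_left_cancel₀ this h]
  · exact fun h => ⟨k, h, rfl⟩

theorem logSum_dilate {n : ℕ} (hn : 0 < n) (A : Set ℤ) (x : ℕ) :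
    logSum (dilate n A) x = (1 / n) * logSum A (x / n) := by
  unfold logSum
  rw [Finset.mul_sum]
  symm
  refine Finset.sum_of_injOn (fun k => n * k) ?_ ?_ ?_ ?_
  · intro a _ b _ h
    exact Nat.eq_of_mul_eq_mul_left hn h
  · intro a ha
    simp only [Finset.coe_Icc, mem_Icc] at *
    refine ⟨Nat.mul_pos hn ha.1, ?_⟩
    rw [mul_comm]
    exact (Nat.le_div_iff_mul_le hn).1 ha.2
  · intro m hm hm'
    refine indicator_of_notMem ?_ _
    rintro ⟨k, _, hk⟩
    refine hm' ?_
    simp only [Finset.mem_Icc] at hm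
    have hn' : (0 : ℤ) < n := by exact_mod_cast hn
    have hk0 : 0 < k := by
      by_contra hc
      have : (n : ℤ) * k ≤ 0 := mul_nonpos_of_nonneg_of_nonpos hn'.le (by omega)
      omega
    lift k to ℕ using hk0.le
    have hmk : m = n * k := by exact_mod_cast hk
    refine ⟨k, ?_, hmk.symm⟩
    simp only [Finset.coe_Icc, mem_Icc]
    refine ⟨by omega, ?_⟩
    rw [Nat.le_div_iff_mul_le hn, mul_comm, ← hmk]
    exact hm.2
  · intro k _
    by_cases hk : (k : ℤ) ∈ A
    · have : ((n * k : ℕ) : ℤ) ∈ dilate n A := by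
        push_cast
        exact (mul_mem_dilate hn).2 hk
      rw [indicator_of_mem hk, indicator_of_mem this]
      push_cast
      rw [one_div_mul_one_div]
    · have : ((n * k : ℕ) : ℤ) ∉ dilate n A := by
        push_cast
        exact fun h => hk ((mul_mem_dilate hn).1 h)
      rw [indicator_of_notMem hk, indicator_of_notMem this, mul_zero]

theorem HasLogDensity.dilate {A : Set ℤ} {d : ℝ} (h : HasLogDensity A d) {n : ℕ} (hn : 0 < n) :
    HasLogDensity (dilate n A) (d / n) := by
  have hn1 : (1 : ℝ) ≤ n := by exact_mod_cast hn
  have := h.of_abs_le (A' := BFree.dilate n A) (c := 1 / n) (K := 1 + Real.log n) fun x => by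
    rw [logSum_dilate hn, ← mul_sub, abs_mul, abs_of_nonneg (by positivity)]
    have hle : logSum A (x / n) ≤ logSum A x :=
      Finset.sum_le_sum_of_subset_of_nonneg (Finset.Icc_subset_Icc_right (Nat.div_le_self _ _))
        fun k _ _ => indicator_one_div_nonneg A k
    -- The increment from x/n to x is at most that of the full harmonic sum, because the complement
    -- of A also has a nonnegative increment.
    have hdiff : logSum A x - logSum A (x / n) ≤ logSum univ x - logSum univ (x / n) := by
      have e1 := logSum_union (A := A) (A' := Aᶜ) disjoint_compl_right x
      have e2 := logSum_union (A := A) (A' := Aᶜ) disjoint_compl_right (x / n)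
      rw [union_compl_self] at e1 e2
      have : logSum Aᶜ (x / n) ≤ logSum Aᶜ x :=
        Finset.sum_le_sum_of_subset_of_nonneg (Finset.Icc_subset_Icc_right (Nat.div_le_self _ _))
          fun k _ _ => indicator_one_div_nonneg _ k
      linarith
    have h3 : logSum univ x - logSum univ (x / n) ≤ 1 + Real.log n := by
      have h1 := logSum_univ_le x
      have h2 := log_le_logSum_univ (x / n)
      rcases Nat.eq_zero_or_pos x with rfl | hx
      · simp only [Nat.zero_div, sub_self]
        linarith [Real.log_nonneg hn1]
      · have h4 : Real.log x ≤ Real.log n + Real.log ((x / n : ℕ) + 1) := by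
          rw [← Real.log_mul (by positivity) (by positivity)]
          refine Real.log_le_log (by exact_mod_cast hx) ?_
          have := (Nat.lt_mul_div_succ x hn).le
          exact_mod_cast this
        linarith
    have h0 : |logSum A (x / n) - logSum A x| ≤ 1 + Real.log n := by
      rw [abs_sub_comm, abs_of_nonneg (by linarith)]
      linarith
    calc 1 / (n : ℝ) * |logSum A (x / n) - logSum A x| ≤ 1 * (1 + Real.log n) := by
          refine mul_le_mul ?_ h0 (abs_nonneg _) zero_le_one
          rw [div_le_one (by positivity)]
          exact hn1
      _ = _ := one_mul _
  rwa [one_div_mul_eq_div] at this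

open Classical in
/-- A periodic set has a logarithmic density, the proportion of a period that it fills. -/
theorem hasLogDensity_of_periodic {A : Set ℤ} {N : ℕ} (hN : 0 < N)
    (hA : ∀ m : ℤ, m + N ∈ A ↔ m ∈ A) :
    HasLogDensity A (((Finset.range N).filter fun j : ℕ => (j : ℤ) ∈ A).card / N) := by
  set c := ((Finset.range N).filter fun j : ℕ => (j : ℤ) ∈ A).card with hc
  -- Sliding a window of length N by one step loses k and gains k + N, which lie in A together or
  -- not at all.
  have hcount : ∀ k : ℕ, ((Finset.range N).filter fun j : ℕ => (k : ℤ) + (j : ℤ) ∈ A).card = c := by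
    intro k
    induction k with
    | zero => simp [hc]
    | succ k ih =>
      rw [← ih, Finset.card_filter, Finset.card_filter]
      have h1 := Finset.sum_range_succ (fun j : ℕ => if (k : ℤ) + (j : ℤ) ∈ A then 1 else 0) N
      rw [Finset.sum_range_succ'] at h1
      simp only [hA, Nat.cast_zero, add_zero] at h1
      rw [← Nat.add_right_cancel h1]
      refine Finset.sum_congr rfl fun j _ => ?_
      push_cast
      rw [add_assoc, add_comm (1 : ℤ)]
  have hsum : ∀ n, ∑ j ∈ Finset.range N, logSum {m | m + ((j : ℕ) : ℤ) ∈ A} n = c * logSum univ n := by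
    intro n
    unfold logSum
    rw [Finset.sum_comm, Finset.mul_sum]
    refine Finset.sum_congr rfl fun k _ => ?_
    rw [← hcount k, Finset.card_filter]
    push_cast
    rw [Finset.sum_mul]
    refine Finset.sum_congr rfl fun j _ => ?_
    simp [indicator_apply]
  have hN' : (0 : ℝ) < N := by exact_mod_cast hN
  have := hasLogDensity_univ.of_abs_le (A' := A) (c := c / N) (K := 2 * N) fun n => by
    have h1 : |∑ j ∈ Finset.range N, (logSum {m | m + ((j : ℕ) : ℤ) ∈ A} n - logSum A n)| ≤
        ∑ j ∈ Finset.range N, (2 * N : ℝ) := by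
      refine (Finset.abs_sum_le_sum_abs _ _).trans (Finset.sum_le_sum fun j hj => ?_)
      refine (abs_logSum_shift_nat_sub_le A j n).trans ?_
      have : (j : ℝ) ≤ N := by exact_mod_cast (Finset.mem_range.1 hj).le
      linarith
    rw [Finset.sum_sub_distrib, hsum] at h1
    simp only [Finset.sum_const, Finset.card_range, nsmul_eq_mul] at h1
    rw [abs_sub_comm]
    have h2 : (c : ℝ) / N * logSum univ n - logSum A n =
        (1 / N) * (c * logSum univ n - N * logSum A n) := by
      field_simp
    rw [h2, abs_mul, abs_of_pos (by positivity), one_div_mul_eq_div, div_le_iff₀ hN', mul_comm _ (N : ℝ)]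
    exact h1
  rwa [mul_one] at this

theorem hasLogDensity_modEq {l : ℕ} (hl : 0 < l) (r : ℤ) :
    HasLogDensity {m | (l : ℤ) ∣ m - r} (1 / l) := by
  have h := (hasLogDensity_univ.dilate hl).shift (-r)
  refine (congrArg (HasLogDensity · _) ?_).mp h
  ext m
  simp [dilate, dvd_def, sub_eq_add_neg]

/-! ### Mertens' upper bound for `∏_{p ≤ x} (1 - 1/p)⁻¹` -/

/-- Each dyadic block (2^k, 2^(k+1)] contributes at most θ(2^(k+1)) / 2^k, and Chebyshev's bound
makes this at most 2 log 4. -/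
theorem sum_log_div_primesLE_two_pow (k : ℕ) :
    ∑ p ∈ Nat.primesLE (2 ^ k), Real.log p / p ≤ 2 * Real.log 4 * k := by
  induction k with
  | zero => simp
  | succ k ih =>
    have hsub : Nat.primesLE (2 ^ k) ⊆ Nat.primesLE (2 ^ (k + 1)) := fun p hp => by
      rw [Nat.mem_primesLE] at *
      exact ⟨hp.1.trans (Nat.pow_le_pow_right (by norm_num) (Nat.le_succ k)), hp.2⟩
    rw [← Finset.sum_sdiff hsub]
    have h1 : ∑ p ∈ Nat.primesLE (2 ^ (k + 1)) \ Nat.primesLE (2 ^ k), Real.log p / p ≤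
        2 * Real.log 4 := by
      calc ∑ p ∈ Nat.primesLE (2 ^ (k + 1)) \ Nat.primesLE (2 ^ k), Real.log p / p
          ≤ ∑ p ∈ Nat.primesLE (2 ^ (k + 1)) \ Nat.primesLE (2 ^ k), Real.log p / 2 ^ k := by
            refine Finset.sum_le_sum fun p hp => ?_
            rw [Finset.mem_sdiff, Nat.mem_primesLE, Nat.mem_primesLE] at hp
            have : 2 ^ k < p := by
              by_contra hc
              exact hp.2 ⟨not_lt.1 hc, hp.1.2⟩
            have h2 : (2 : ℝ) ^ k ≤ p := by exact_mod_cast this.le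
            have := Real.log_natCast_nonneg p
            gcongr
        _ ≤ ∑ p ∈ Nat.primesLE (2 ^ (k + 1)), Real.log p / 2 ^ k := by
            refine Finset.sum_le_sum_of_subset_of_nonneg Finset.sdiff_subset fun p _ _ => ?_
            have := Real.log_natCast_nonneg p
            positivity
        _ = Chebyshev.theta ((2 ^ (k + 1) : ℕ) : ℝ) / 2 ^ k := by
            rw [Chebyshev.theta_eq_sum_primesLE_log, Finset.sum_div]
        _ ≤ Real.log 4 * ((2 ^ (k + 1) : ℕ) : ℝ) / 2 ^ k := by
            gcongr
            exact Chebyshev.theta_le_log4_mul_x (by positivity)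
        _ = 2 * Real.log 4 := by
            push_cast
            rw [pow_succ]
            field_simp
    push_cast
    linarith

theorem exists_sum_log_div_primesLE_le :
    ∃ C : ℝ, 0 ≤ C ∧ ∀ᶠ x : ℕ in atTop, ∑ p ∈ Nat.primesLE x, Real.log p / p ≤ C * Real.log x := by
  have hl2 : 0 < Real.log 2 := Real.log_pos (by norm_num)
  have hl4 : 0 ≤ Real.log 4 := Real.log_nonneg (by norm_num)
  refine ⟨2 * Real.log 4 * (1 / Real.log 2 + 1), by positivity, ?_⟩
  filter_upwards [eventually_gt_atTop 0, tendsto_log_natCast.eventually_ge_atTop 1] with x hx hx1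
  have hsub : Nat.primesLE x ⊆ Nat.primesLE (2 ^ (Nat.log 2 x + 1)) := fun p hp => by
    rw [Nat.mem_primesLE] at *
    exact ⟨hp.1.trans (Nat.lt_pow_succ_log_self (by norm_num) x).le, hp.2⟩
  have hlog : (Nat.log 2 x : ℝ) ≤ Real.log x / Real.log 2 := by
    rw [le_div_iff₀ hl2, ← Real.log_pow]
    refine Real.log_le_log (by positivity) ?_
    exact_mod_cast Nat.pow_log_le_self 2 hx.ne'
  calc ∑ p ∈ Nat.primesLE x, Real.log p / p
      ≤ ∑ p ∈ Nat.primesLE (2 ^ (Nat.log 2 x + 1)), Real.log p / p := by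
        refine Finset.sum_le_sum_of_subset_of_nonneg hsub fun p _ _ => ?_
        have := Real.log_natCast_nonneg p
        positivity
    _ ≤ 2 * Real.log 4 * ((Nat.log 2 x + 1 : ℕ) : ℝ) := sum_log_div_primesLE_two_pow _
    _ ≤ 2 * Real.log 4 * (Real.log x / Real.log 2 + Real.log x) := by
        push_cast
        gcongr
    _ = _ := by ring

/-- The function `n ↦ n ^ (-s)` as a monoid homomorphism. -/
def rpowNegHom (s : ℝ) : ℕ →* ℝ where
  toFun n := (n : ℝ) ^ (-s)
  map_one' := by simp
  map_mul' m n := by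
    push_cast
    exact Real.mul_rpow (Nat.cast_nonneg _) (Nat.cast_nonneg _)

theorem prod_primesLE_le_tsum {s : ℝ} (hs : 1 < s) (x : ℕ) :
    ∏ p ∈ Nat.primesLE x, (1 - (p : ℝ) ^ (-s))⁻¹ ≤ ∑' n : ℕ, 1 / (n : ℝ) ^ s := by
  have hsum : Summable (rpowNegHom s) := by
    have : Summable fun n : ℕ => (n : ℝ) ^ (-s) := Real.summable_nat_rpow.2 (by linarith)
    exact this
  have h := EulerProduct.prod_primesBelow_geometric_eq_tsum_smoothNumbers hsum (x + 1)
  have h' : ∏ p ∈ Nat.primesLE x, (1 - (p : ℝ) ^ (-s))⁻¹ =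
      ∑' m : (x + 1).smoothNumbers, rpowNegHom s m := h
  rw [h']
  have h2 : ∑' n : ℕ, 1 / (n : ℝ) ^ s = ∑' n : ℕ, rpowNegHom s n := by
    refine tsum_congr fun n => ?_
    simp [rpowNegHom, Real.rpow_neg]
  rw [h2]
  exact hsum.tsum_subtype_le _ (Nat.smoothNumbers (x + 1)) fun n => by
    change 0 ≤ (n : ℝ) ^ (-s)
    positivity

/-- Compares the Euler factors at 1 + δ and at 1. The 2 in the exponent compensates for 1 - 1/p ≥
1/2. -/
theorem one_sub_rpow_neg_le {p : ℕ} (hp : 2 ≤ p) {δ : ℝ} (hδ : 0 < δ) :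
    1 - (p : ℝ) ^ (-(1 + δ)) ≤ (1 - 1 / p) * Real.exp (2 * δ * (Real.log p / p)) := by
  have hp2 : (2 : ℝ) ≤ p := by exact_mod_cast hp
  have hp0 : (0 : ℝ) < p := by linarith
  have hlog : 0 ≤ Real.log p := Real.log_natCast_nonneg p
  have h1 : (p : ℝ) ^ (-(1 + δ)) = 1 / p * Real.exp (-(δ * Real.log p)) := by
    rw [neg_add, Real.rpow_add hp0, Real.rpow_neg_one, one_div, Real.rpow_def_of_pos hp0]
    congr 2
    ring
  have h2 : 1 - δ * Real.log p ≤ Real.exp (-(δ * Real.log p)) := Real.one_sub_le_exp_neg _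
  have h3 : 2 * δ * (Real.log p / p) + 1 ≤ Real.exp (2 * δ * (Real.log p / p)) :=
    Real.add_one_le_exp _
  have h4 : (1 : ℝ) / p ≤ 1 / 2 := by gcongr
  have h5 : 0 ≤ δ * (Real.log p / p) := by positivity
  calc 1 - (p : ℝ) ^ (-(1 + δ)) ≤ 1 - 1 / p * (1 - δ * Real.log p) := by
        rw [h1]
        gcongr
    _ = (1 - 1 / p) + δ * (Real.log p / p) := by ring
    _ ≤ (1 - 1 / p) * (2 * δ * (Real.log p / p) + 1) := by nlinarith
    _ ≤ _ := by
        have : (0 : ℝ) ≤ 1 - 1 / p := by linarith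
        gcongr

/-- **Mertens' upper bound**: `∏_{p ≤ x} (1 - 1/p)⁻¹ = O(log x)`. -/
theorem exists_one_le_mul_log_mul_prod :
    ∃ C : ℝ, 0 < C ∧ ∀ᶠ x : ℕ in atTop,
      1 ≤ C * Real.log x * ∏ p ∈ Nat.primesLE x, (1 - 1 / (p : ℝ)) := by
  obtain ⟨C, hC, hCx⟩ := exists_sum_log_div_primesLE_le
  -- The 2 comes from ζ(s) ≤ 2/(s - 1) near s = 1; the exponential is the cost of replacing s = 1 +
  -- 1/log x by 1 in the Euler product.
  refine ⟨2 * Real.exp (2 * C), by positivity, ?_⟩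
  have hs : Tendsto (fun x : ℕ => 1 + 1 / Real.log x) atTop (𝓝[>] 1) := by
    refine tendsto_nhdsWithin_iff.2 ⟨?_, ?_⟩
    · have := (tendsto_const_nhds (x := (1 : ℝ))).div_atTop tendsto_log_natCast
      simpa using this.const_add (1 : ℝ)
    · filter_upwards [tendsto_log_natCast.eventually_gt_atTop 0] with x hx
      rw [mem_Ioi]
      have : 0 < 1 / Real.log x := by positivity
      linarith
  have hz := hs.eventually (tendsto_sub_mul_tsum_nat_rpow.eventually (gt_mem_nhds one_lt_two))
  filter_upwards [hCx, hz, tendsto_log_natCast.eventually_gt_atTop 0] with x h1 h2 hx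
  set δ := 1 / Real.log x with hδ
  have hδ0 : 0 < δ := by positivity
  have hprime : ∀ p ∈ Nat.primesLE x, 2 ≤ p := fun p hp => (Nat.mem_primesLE.1 hp).2.two_le
  have h3 := prod_primesLE_le_tsum (s := 1 + δ) (by linarith) x
  have h4 : ∑' n : ℕ, 1 / (n : ℝ) ^ (1 + δ) ≤ 2 * Real.log x := by
    rw [add_sub_cancel_left, hδ, one_div_mul_eq_div, div_lt_iff₀ hx] at h2
    exact h2.le
  have hpos : ∀ p ∈ Nat.primesLE x, 0 < 1 - (p : ℝ) ^ (-(1 + δ)) := fun p hp => by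
    have : (1 : ℝ) < p := by exact_mod_cast hprime p hp
    have := Real.rpow_lt_one_of_one_lt_of_neg this (z := -(1 + δ)) (by linarith)
    linarith
  have h5 : ∏ p ∈ Nat.primesLE x, (1 - (p : ℝ) ^ (-(1 + δ))) ≤
      (∏ p ∈ Nat.primesLE x, (1 - 1 / (p : ℝ))) * Real.exp (2 * C) := by
    calc ∏ p ∈ Nat.primesLE x, (1 - (p : ℝ) ^ (-(1 + δ)))
        ≤ ∏ p ∈ Nat.primesLE x, ((1 - 1 / (p : ℝ)) * Real.exp (2 * δ * (Real.log p / p))) :=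
          Finset.prod_le_prod (fun p hp => (hpos p hp).le)
            fun p hp => one_sub_rpow_neg_le (hprime p hp) hδ0
      _ = (∏ p ∈ Nat.primesLE x, (1 - 1 / (p : ℝ))) *
            Real.exp (2 * δ * ∑ p ∈ Nat.primesLE x, Real.log p / p) := by
          rw [Finset.prod_mul_distrib, ← Real.exp_sum, Finset.mul_sum]
      _ ≤ _ := by
          have h0 : 0 ≤ ∏ p ∈ Nat.primesLE x, (1 - 1 / (p : ℝ)) := by
            refine Finset.prod_nonneg fun p hp => ?_
            have : (2 : ℝ) ≤ p := by exact_mod_cast hprime p hp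
            rw [sub_nonneg, div_le_one (by linarith)]
            linarith
          refine mul_le_mul_of_nonneg_left (Real.exp_le_exp.2 ?_) h0
          calc 2 * δ * ∑ p ∈ Nat.primesLE x, Real.log p / p ≤ 2 * δ * (C * Real.log x) := by
                gcongr
            _ = 2 * C := by
                rw [hδ]
                field_simp
  have hP : 0 < ∏ p ∈ Nat.primesLE x, (1 - (p : ℝ) ^ (-(1 + δ))) := Finset.prod_pos hpos
  rw [Finset.prod_inv_distrib] at h3
  have h6 : 1 ≤ 2 * Real.log x * ∏ p ∈ Nat.primesLE x, (1 - (p : ℝ) ^ (-(1 + δ))) := by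
    rw [← div_le_iff₀ hP, one_div]
    exact h3.trans h4
  calc (1 : ℝ) ≤ 2 * Real.log x * ∏ p ∈ Nat.primesLE x, (1 - (p : ℝ) ^ (-(1 + δ))) := h6
    _ ≤ 2 * Real.log x * ((∏ p ∈ Nat.primesLE x, (1 - 1 / (p : ℝ))) * Real.exp (2 * C)) := by
        gcongr
    _ = _ := by ring

theorem totient_primorial_div (x : ℕ) :
    ((primorial x).totient : ℝ) / primorial x = ∏ p ∈ Nat.primesLE x, (1 - 1 / (p : ℝ)) := by
  have h := Nat.totient_eq_mul_prod_factors (primorial x)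
  rw [primeFactors_primorial] at h
  have h' : ((primorial x).totient : ℝ) =
      primorial x * ∏ p ∈ Nat.primesLE x, (1 - (p : ℝ)⁻¹) := by
    have := congrArg (fun q : ℚ => (q : ℝ)) h
    push_cast at this
    exact this
  have h0 : (primorial x : ℝ) ≠ 0 := by exact_mod_cast primorial_ne_zero x
  rw [h', mul_div_cancel_left₀ _ h0]
  simp

/-! ### Sets of multiples -/

theorem mem_free {C : Set ℕ} {n : ℤ} : n ∈ free C ↔ ∀ c ∈ C, ¬(c : ℤ) ∣ n := by
  simp [free, multiples]

theorem notMem_free {C : Set ℕ} {n : ℤ} : n ∉ free C ↔ ∃ c ∈ C, (c : ℤ) ∣ n := by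
  simp [free, multiples]

theorem compl_free (C : Set ℕ) : (free C)ᶜ = multiples C :=
  compl_compl _

theorem free_anti {C C' : Set ℕ} (h : C ⊆ C') : free C' ⊆ free C := fun n hn => by
  rw [mem_free] at *
  exact fun c hc => hn c (h hc)

theorem add_mem_free_iff {C : Set ℕ} {N : ℤ} (hN : ∀ c ∈ C, (c : ℤ) ∣ N) (m : ℤ) :
    m + N ∈ free C ↔ m ∈ free C := by
  simp only [mem_free]
  refine forall₂_congr fun c hc => ?_
  rw [dvd_add_left (hN c hc)]

theorem finset_lcm_pos {S : Finset ℕ} (hS : ∀ c ∈ S, 0 < c) : 0 < S.lcm id := by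
  refine Nat.pos_of_ne_zero fun h => ?_
  rw [Finset.lcm_eq_zero_iff] at h
  obtain ⟨c, hc, h0⟩ := h
  exact (hS c hc).ne' h0

theorem hasLogDensity_free_finset {S : Finset ℕ} (hS : ∀ c ∈ S, 0 < c) :
    ∃ d, HasLogDensity (free (S : Set ℕ)) d :=
  ⟨_, hasLogDensity_of_periodic (finset_lcm_pos hS) (add_mem_free_iff fun _ hc =>
    Int.natCast_dvd_natCast.2 (Finset.dvd_lcm (f := id) (Finset.mem_coe.1 hc)))⟩

/-! ### The theorem of Davenport and Erdős -/

theorem hasLogDensity_coprime {Q : ℕ} (hQ : 0 < Q) :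
    HasLogDensity {m : ℤ | IsCoprime (Q : ℤ) m} (Q.totient / Q) := by
  classical
  have h := hasLogDensity_of_periodic (A := {m : ℤ | IsCoprime (Q : ℤ) m}) hQ fun m => by
    simp only [mem_ofPred_eq]
    simpa using IsCoprime.add_mul_left_right_iff (x := (Q : ℤ)) (y := m) (z := 1)
  have hc : ((Finset.range Q).filter fun j : ℕ => (j : ℤ) ∈ {m : ℤ | IsCoprime (Q : ℤ) m}).card =
      Q.totient := by
    rw [Nat.totient_eq_card_coprime]
    congr 1
    ext j
    simp [Nat.isCoprime_iff_coprime]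
  rw [← hc]
  convert h

theorem isCoprime_of_le_of_isCoprime_primorial {c x : ℕ} (hcx : c ≤ x) (hc : 0 < c) {m : ℤ}
    (hm : IsCoprime (primorial x : ℤ) m) : IsCoprime (c : ℤ) m := by
  rw [Int.isCoprime_iff_gcd_eq_one] at *
  by_contra h
  obtain ⟨p, hp, hpd⟩ := Nat.exists_prime_and_dvd h
  have h1 : (p : ℤ) ∣ c := (Int.natCast_dvd_natCast.2 hpd).trans (Int.gcd_dvd_left _ _)
  have h2 : (p : ℤ) ∣ m := (Int.natCast_dvd_natCast.2 hpd).trans (Int.gcd_dvd_right _ _)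
  have h3 : p ∣ primorial x :=
    hp.dvd_primorial_iff.2 ((Nat.le_of_dvd hc (Int.natCast_dvd_natCast.1 h1)).trans hcx)
  have h4 := Int.dvd_gcd (Int.natCast_dvd_natCast.2 h3) h2
  rw [hm] at h4
  exact hp.one_lt.ne' (Nat.dvd_one.1 (by exact_mod_cast h4))

theorem mul_mem_free_iff {C : Set ℕ} {m : ℤ} (h : ∀ c ∈ C, IsCoprime (c : ℤ) m) (n : ℤ) :
    n * m ∈ free C ↔ n ∈ free C := by
  simp only [mem_free]
  exact forall₂_congr fun c hc => not_congr
    ⟨fun hd => (h c hc).dvd_of_dvd_mul_right hd, fun hd => hd.mul_right _⟩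

/-- Let Q be the product of the primes up to x and E the difference set. For n ∈ E with n ≤ x, the
products nm with m coprime to Q stay in E, and they determine n. So E contains disjoint sets of
density φ(Q)/(Qn). With Mertens' bound, this controls the partial sum up to x by the density of E,
uniformly in the finite sets. -/
theorem logSum_mul_totient_le {S S' : Finset ℕ} {x : ℕ} (hS : ∀ c ∈ S, 0 < c ∧ c ≤ x)
    (hS' : ∀ c ∈ S', 0 < c ∧ c ≤ x) {d : ℝ}
    (hd : HasLogDensity (free (S : Set ℕ) \ free (S' : Set ℕ)) d) :
    logSum (free (S : Set ℕ) \ free (S' : Set ℕ)) x *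
      ((primorial x).totient / primorial x) ≤ d := by
  classical
  set E := free (S : Set ℕ) \ free (S' : Set ℕ) with hE
  set Q := primorial x with hQdef
  have hQ : 0 < Q := primorial_pos x
  set T := (Finset.Icc 1 x).filter fun n : ℕ => (n : ℤ) ∈ E with hT
  have hTx : ∀ n ∈ T, (0 < n ∧ n ≤ x) ∧ (n : ℤ) ∈ E := fun n hn => by
    rw [hT, Finset.mem_filter, Finset.mem_Icc] at hn
    exact hn
  have hU := hasLogDensity_biUnion T (fun n => dilate n {m : ℤ | IsCoprime (Q : ℤ) m})
    (fun n => (Q.totient / Q : ℝ) / n)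
    (fun n hn => (hasLogDensity_coprime hQ).dilate (hTx n hn).1.1) ?_
  · have hsub : (⋃ n ∈ T, dilate n {m : ℤ | IsCoprime (Q : ℤ) m}) ⊆ E := by
      refine iUnion₂_subset fun n hn => ?_
      rintro _ ⟨m, hm, rfl⟩
      have hcop : ∀ c : ℕ, (0 < c ∧ c ≤ x) → IsCoprime (c : ℤ) m := fun c hc =>
        isCoprime_of_le_of_isCoprime_primorial hc.2 hc.1 hm
      refine ⟨(mul_mem_free_iff (fun c hc => hcop c (hS c hc)) _).2 (hTx n hn).2.1, fun h => ?_⟩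
      exact (hTx n hn).2.2 ((mul_mem_free_iff (fun c hc => hcop c (hS' c hc)) _).1 h)
    refine le_trans (le_of_eq ?_) (hU.mono hd hsub)
    unfold logSum
    rw [Finset.sum_mul, hT, Finset.sum_filter]
    refine Finset.sum_congr rfl fun n _ => ?_
    rw [indicator_apply]
    split_ifs
    · push_cast
      ring
    · simp
  · intro n hn n' hn' hne
    refine disjoint_left.2 ?_
    rintro _ ⟨m, hm, rfl⟩ ⟨m', hm', heq⟩
    refine hne (Nat.dvd_antisymm ?_ ?_)
    · have h := isCoprime_of_le_of_isCoprime_primorial (hTx n hn).1.2 (hTx n hn).1.1 hm'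
      exact Int.natCast_dvd_natCast.1 (h.dvd_of_dvd_mul_right (heq ▸ dvd_mul_right _ _))
    · have h := isCoprime_of_le_of_isCoprime_primorial (hTx n' hn').1.2 (hTx n' hn').1.1 hm
      exact Int.natCast_dvd_natCast.1 (h.dvd_of_dvd_mul_right (heq ▸ dvd_mul_right _ _))

theorem logSum_congr {A A' : Set ℤ} {x : ℕ}
    (h : ∀ k : ℕ, 0 < k → k ≤ x → ((k : ℤ) ∈ A ↔ (k : ℤ) ∈ A')) : logSum A x = logSum A' x := by
  classical
  refine Finset.sum_congr rfl fun k hk => ?_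
  rw [Finset.mem_Icc] at hk
  simp only [indicator_apply, h k hk.1 hk.2]

/-- **Theorem of Davenport and Erdős**: the set of `C`-free integers has a logarithmic density,
which is the infimum of the densities of the sets of `S`-free integers for finite `S ⊆ C`. -/
theorem exists_hasLogDensity_free {C : Set ℕ} (hC : ∀ c ∈ C, 0 < c) :
    ∃ D, HasLogDensity (free C) D ∧ ∀ ε > 0, ∃ S : Finset ℕ, (S : Set ℕ) ⊆ C ∧
      ∃ d, HasLogDensity (free (S : Set ℕ)) d ∧ d < D + ε := by
  classical
  set V : Set ℝ := {d | ∃ S : Finset ℕ, (S : Set ℕ) ⊆ C ∧ HasLogDensity (free (S : Set ℕ)) d}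
    with hV
  have hVne : V.Nonempty := by
    obtain ⟨d, hd⟩ := hasLogDensity_free_finset (S := ∅) (by simp)
    exact ⟨d, ∅, by simp, hd⟩
  have hVbdd : BddBelow V := ⟨0, by
    rintro d ⟨S, -, hd⟩
    exact hd.nonneg⟩
  have happ : ∀ a, sInf V < a → ∃ S : Finset ℕ, (S : Set ℕ) ⊆ C ∧
      ∃ d, HasLogDensity (free (S : Set ℕ)) d ∧ d < a := fun a ha => by
    obtain ⟨d, ⟨S, hS, hd⟩, hlt⟩ := exists_lt_of_csInf_lt hVne ha
    exact ⟨S, hS, d, hd, hlt⟩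
  refine ⟨sInf V, ?_, fun ε hε => happ _ (by linarith)⟩
  obtain ⟨K, hK, hmertens⟩ := exists_one_le_mul_log_mul_prod
  rw [hasLogDensity_iff, tendsto_order]
  constructor
  · intro a ha
    -- The loss will be ε from S at the cutoff x and Kε from the elements of C outside S.
    set ε := (sInf V - a) / (2 * (1 + K)) with hε
    have hε0 : 0 < ε := by
      have : 0 < sInf V - a := by linarith
      positivity
    have hεa : a < sInf V - ε - K * ε := by
      have : ε * (2 * (1 + K)) = sInf V - a := by
        rw [hε]
        field_simp
      nlinarith
    obtain ⟨S, hSC, d, hd, hlt⟩ := happ (sInf V + ε) (by linarith)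
    have hdV : sInf V ≤ d := csInf_le hVbdd ⟨S, hSC, hd⟩
    have hev := (tendsto_order.1 (hasLogDensity_iff.1 hd)).1 (sInf V - ε) (by linarith)
    filter_upwards [hev, hmertens, eventually_ge_atTop (S.sup id), eventually_gt_atTop 1]
      with x h1 h2 hxS hx1
    have hlog : 0 < Real.log x := Real.log_pos (by exact_mod_cast hx1)
    -- Up to x, the sets free of C and of S' agree. Both densities d and d' lie in [inf V, inf V +
    -- ε], so the difference set has density at most ε, however large x is.
    set S' := S ∪ (Finset.Icc 1 x).filter (· ∈ C) with hS'
    have hS'C : (S' : Set ℕ) ⊆ C := by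
      intro c hc
      rw [hS', Finset.coe_union, mem_union] at hc
      rcases hc with hc | hc
      · exact hSC hc
      · exact (Finset.mem_filter.1 hc).2
    have hSx : ∀ c ∈ S, 0 < c ∧ c ≤ x := fun c hc =>
      ⟨hC c (hSC hc), (Finset.le_sup (f := id) hc).trans hxS⟩
    have hS'x : ∀ c ∈ S', 0 < c ∧ c ≤ x := fun c hc => by
      rw [hS', Finset.mem_union, Finset.mem_filter, Finset.mem_Icc] at hc
      rcases hc with hc | hc
      · exact hSx c hc
      · exact hc.1
    obtain ⟨d', hd'⟩ := hasLogDensity_free_finset (S := S') fun c hc => (hS'x c hc).1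
    have hd'V : sInf V ≤ d' := csInf_le hVbdd ⟨S', hS'C, hd'⟩
    have hle := logSum_mul_totient_le hSx hS'x (hd.diff hd' (free_anti (by simp [hS'])))
    rw [totient_primorial_div] at hle
    have hcongr : logSum (free C) x = logSum (free (S' : Set ℕ)) x := by
      refine logSum_congr fun k hk0 hkx => ⟨fun h => free_anti hS'C h, fun h => ?_⟩
      rw [mem_free] at *
      intro c hc hck
      have hck' : c ≤ x := (Nat.le_of_dvd hk0 (Int.natCast_dvd_natCast.1 hck)).trans hkx
      refine h c ?_ hck
      simp only [hS', Finset.coe_union, mem_union]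
      right
      simp only [Finset.coe_filter, Finset.mem_Icc, mem_ofPred_eq]
      exact ⟨⟨hC c hc, hck'⟩, hc⟩
    have hsplit : logSum (free (S : Set ℕ)) x = logSum (free (S : Set ℕ) \ free (S' : Set ℕ)) x +
        logSum (free (S' : Set ℕ)) x := by
      rw [← logSum_union disjoint_sdiff_left, sdiff_union_of_subset (free_anti (by simp [hS']))]
    have hE0 := logSum_nonneg (free (S : Set ℕ) \ free (S' : Set ℕ)) x
    have hE : logSum (free (S : Set ℕ) \ free (S' : Set ℕ)) x ≤ K * ε * Real.log x := by
      calc logSum (free (S : Set ℕ) \ free (S' : Set ℕ)) x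
          ≤ logSum (free (S : Set ℕ) \ free (S' : Set ℕ)) x *
            (K * Real.log x * ∏ p ∈ Nat.primesLE x, (1 - 1 / (p : ℝ))) :=
            le_mul_of_one_le_right hE0 h2
        _ = K * Real.log x * (logSum (free (S : Set ℕ) \ free (S' : Set ℕ)) x *
            ∏ p ∈ Nat.primesLE x, (1 - 1 / (p : ℝ))) := by ring
        _ ≤ K * Real.log x * ε := by
            have : d - d' ≤ ε := by linarith
            gcongr
            exact hle.trans this
        _ = _ := by ring
    refine hεa.trans_le ?_
    rw [le_div_iff₀ hlog, hcongr]
    rw [lt_div_iff₀ hlog] at h1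
    linarith
  · intro a ha
    obtain ⟨S, hSC, d, hd, hlt⟩ := happ a ha
    have hev := (tendsto_order.1 (hasLogDensity_iff.1 hd)).2 a hlt
    filter_upwards [hev] with x hx
    refine lt_of_le_of_lt ?_ hx
    have : 0 ≤ Real.log x := Real.log_natCast_nonneg x
    gcongr
    exact logSum_mono (free_anti hSC) x

/-! ### The inequality of Heilbronn, Rohrbach and Behrend -/

/-- The natural numbers, ordered by divisibility. -/
def DvdNat : Type := ℕ

instance : DistribLattice DvdNat where
  le a b := Dvd.dvd (α := ℕ) a b
  le_refl a := Nat.dvd_refl a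
  le_trans _ _ _ := Nat.dvd_trans
  le_antisymm _ _ := Nat.dvd_antisymm
  sup := Nat.lcm
  inf := Nat.gcd
  le_sup_left := Nat.dvd_lcm_left
  le_sup_right := Nat.dvd_lcm_right
  sup_le _ _ _ := Nat.lcm_dvd
  inf_le_left := Nat.gcd_dvd_left
  inf_le_right := Nat.gcd_dvd_right
  le_inf _ _ _ := Nat.dvd_gcd
  le_sup_inf (x y z : ℕ) := by
    change Nat.gcd (Nat.lcm x y) (Nat.lcm x z) ∣ Nat.lcm x (Nat.gcd y z)
    rcases Nat.eq_zero_or_pos x with rfl | hx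
    · simp
    rcases Nat.eq_zero_or_pos y with rfl | hy
    · simp
    rcases Nat.eq_zero_or_pos z with rfl | hz
    · simp
    have h1 := (Nat.lcm_pos hx hy).ne'
    have h2 := (Nat.lcm_pos hx hz).ne'
    have h3 := (Nat.gcd_pos_of_pos_left z hy).ne'
    -- For positive numbers, distributivity is that of min and max on the exponent of each prime.
    rw [← Nat.factorization_le_iff_dvd (Nat.gcd_pos_of_pos_left _ (Nat.lcm_pos hx hy)).ne'
      (Nat.lcm_pos hx (Nat.gcd_pos_of_pos_left z hy)).ne', Nat.factorization_gcd h1 h2,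
      Nat.factorization_lcm hx.ne' hy.ne', Nat.factorization_lcm hx.ne' hz.ne',
      Nat.factorization_lcm hx.ne' h3, Nat.factorization_gcd hy.ne' hz.ne']
    intro p
    simp only [Finsupp.sup_apply, Finsupp.inf_apply]
    exact sup_inf_left (x.factorization p) _ _ |>.ge

/-- The pairs (a, b) and (gcd, lcm) have the same product and the same gcd, and these two determine
the product of the totients. -/
theorem totient_mul_totient_eq (a b : ℕ) :
    a.totient * b.totient = (Nat.gcd a b).totient * (Nat.lcm a b).totient := by
  rcases Nat.eq_zero_or_pos (Nat.gcd a b) with h | h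
  · obtain ⟨rfl, rfl⟩ := Nat.gcd_eq_zero_iff.1 h
    simp
  have h1 := Nat.totient_gcd_mul_totient_mul a b
  have h2 := Nat.totient_gcd_mul_totient_mul (Nat.gcd a b) (Nat.lcm a b)
  have hdvd : Nat.gcd a b ∣ Nat.lcm a b := (Nat.gcd_dvd_left a b).trans (Nat.dvd_lcm_left a b)
  rw [Nat.gcd_eq_left hdvd, Nat.gcd_mul_lcm] at h2
  exact Nat.eq_of_mul_eq_mul_right h (h1.symm.trans h2)

open Classical in
-- Whether j is S-free depends only on gcd(N, j), and φ(e) residues j have gcd(N, j) = N/e. This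
-- turns densities into sums of the weight φ over a family of divisors.
theorem card_free_eq_sum_totient {S : Finset ℕ} {N : ℕ} (hN : 0 < N) (hS : ∀ c ∈ S, c ∣ N) :
    ((Finset.range N).filter fun j : ℕ => (j : ℤ) ∈ free (S : Set ℕ)).card =
      ∑ e ∈ N.divisors.filter fun e => ((N / e : ℕ) : ℤ) ∈ free (S : Set ℕ), e.totient := by
  have hgcd : ∀ j : ℕ, ((Nat.gcd N j : ℕ) : ℤ) ∈ free (S : Set ℕ) ↔ (j : ℤ) ∈ free (S : Set ℕ) := by
    intro j
    simp only [mem_free, Int.natCast_dvd_natCast]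
    refine forall₂_congr fun c hc => ?_
    rw [Nat.dvd_gcd_iff, and_iff_right (hS c hc)]
  rw [Finset.card_eq_sum_card_fiberwise (f := fun j => N / Nat.gcd N j)
    (t := N.divisors.filter fun e => ((N / e : ℕ) : ℤ) ∈ free (S : Set ℕ))]
  · refine Finset.sum_congr rfl fun e he => ?_
    rw [Finset.mem_filter, Nat.mem_divisors] at he
    obtain ⟨⟨heN, -⟩, hefree⟩ := he
    have h1 := Nat.totient_div_of_dvd (Nat.div_dvd_of_dvd heN)
    rw [Nat.div_div_self heN hN.ne'] at h1
    rw [h1, Finset.filter_filter]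
    congr 1
    refine Finset.filter_congr fun j _ => ?_
    have hg := Nat.gcd_dvd_left N j
    constructor
    · rintro ⟨-, h⟩
      rw [← h, Nat.div_div_self hg hN.ne']
    · intro h
      rw [h]
      refine ⟨(hgcd j).1 (h ▸ hefree), Nat.div_div_self heN hN.ne'⟩
  · intro j hj
    have hj' := (Finset.mem_filter.1 (Finset.mem_coe.1 hj)).2
    have hg := Nat.gcd_dvd_left N j
    simp only [Finset.coe_filter, mem_ofPred_eq, Nat.mem_divisors]
    refine ⟨⟨Nat.div_dvd_of_dvd hg, hN.ne'⟩, ?_⟩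
    rw [Nat.div_div_self hg hN.ne']
    exact (hgcd j).2 hj'

theorem free_union (C C' : Set ℕ) : free (C ∪ C') = free C ∩ free C' := by
  ext n
  simp only [mem_inter_iff, mem_free, mem_union]
  exact ⟨fun h => ⟨fun c hc => h c (Or.inl hc), fun c hc => h c (Or.inr hc)⟩,
    fun h c hc => hc.elim (h.1 c) (h.2 c)⟩

theorem mem_free_of_dvd {C : Set ℕ} {m n : ℤ} (hn : n ∈ free C) (h : m ∣ n) : m ∈ free C := by
  rw [mem_free] at *
  exact fun c hc hcm => hn c hc (hcm.trans h)

open FinsetFamily in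
-- A correlation inequality on the divisors of N: the sets `U S` are upward closed there, since
-- enlarging e shrinks N/e.
theorem hasLogDensity_mul_le_of_finset {S T : Finset ℕ} (hS : ∀ c ∈ S, 0 < c)
    (hT : ∀ c ∈ T, 0 < c) {d₁ d₂ d : ℝ} (h₁ : HasLogDensity (free (S : Set ℕ)) d₁)
    (h₂ : HasLogDensity (free (T : Set ℕ)) d₂)
    (h : HasLogDensity (free ((S ∪ T : Finset ℕ) : Set ℕ)) d) : d₁ * d₂ ≤ d := by
  classical
  have hST : ∀ c ∈ S ∪ T, 0 < c := fun c hc => (Finset.mem_union.1 hc).elim (hS c) (hT c)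
  set N := (S ∪ T).lcm id with hNdef
  have hN : 0 < N := finset_lcm_pos hST
  have hdvd : ∀ c ∈ S ∪ T, c ∣ N := fun c hc => Finset.dvd_lcm (f := id) hc
  let U : Finset ℕ → Finset DvdNat := fun S' =>
    N.divisors.filter fun e : ℕ => ((N / e : ℕ) : ℤ) ∈ free (S' : Set ℕ)
  let φ : DvdNat → ℕ := Nat.totient
  have key : ∀ S' ⊆ S ∪ T, ∀ d', HasLogDensity (free (S' : Set ℕ)) d' →
      N * d' = ((∑ e ∈ U S', φ e : ℕ) : ℝ) := by
    intro S' hS' d' hd'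
    have h1 := hasLogDensity_of_periodic hN (add_mem_free_iff (C := (S' : Set ℕ)) (N := (N : ℤ))
      fun c hc => Int.natCast_dvd_natCast.2 (hdvd c (hS' hc)))
    rw [hd'.unique h1, card_free_eq_sum_totient hN fun c hc => hdvd c (hS' hc)]
    have : (N : ℝ) ≠ 0 := by exact_mod_cast hN.ne'
    rw [mul_div_cancel₀ _ this]
    rfl
  have hmemU : ∀ {S'} {e : ℕ}, (e : DvdNat) ∈ U S' ↔ e ∣ N ∧ ((N / e : ℕ) : ℤ) ∈ free (S' : Set ℕ) := by
    intro S' e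
    refine Finset.mem_filter.trans ?_
    rw [Nat.mem_divisors, and_iff_left hN.ne']
  -- All four functions are the totient, whose log-modularity is the required hypothesis. Meets are
  -- divisors of N, of total weight at most N; joins lie in `U (S ∪ T)`.
  have four := four_functions_theorem φ φ φ φ (fun _ => Nat.zero_le _) (fun _ => Nat.zero_le _)
    (fun _ => Nat.zero_le _) (fun _ => Nat.zero_le _)
    (fun a b => (totient_mul_totient_eq a b).le) (U S) (U T)
  have hinf : ∑ e ∈ (U S ⊼ U T), φ e ≤ N := by
    have : (U S ⊼ U T) ⊆ (N.divisors : Finset ℕ) := by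
      intro e he
      obtain ⟨a, ha, b, hb, rfl⟩ := Finset.mem_infs.1 he
      refine Nat.mem_divisors.2 ⟨?_, hN.ne'⟩
      exact (Nat.gcd_dvd_left a b).trans (hmemU.1 ha).1
    calc ∑ e ∈ (U S ⊼ U T), φ e ≤ ∑ e ∈ N.divisors, Nat.totient e :=
          Finset.sum_le_sum_of_subset this
      _ = N := Nat.sum_totient N
  have hsup : ∑ e ∈ (U S ⊻ U T), φ e ≤ ∑ e ∈ U (S ∪ T), φ e := by
    refine Finset.sum_le_sum_of_subset fun e he => ?_
    obtain ⟨a, ha, b, hb, rfl⟩ := Finset.mem_sups.1 he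
    have ha' := hmemU.1 ha
    have hb' := hmemU.1 hb
    have hl : Nat.lcm a b ∣ N := Nat.lcm_dvd ha'.1 hb'.1
    refine hmemU.2 ⟨hl, ?_⟩
    rw [Finset.coe_union, free_union]
    exact ⟨mem_free_of_dvd ha'.2 (Int.natCast_dvd_natCast.2
        (Nat.div_dvd_div_left hl (Nat.dvd_lcm_left a b))),
      mem_free_of_dvd hb'.2 (Int.natCast_dvd_natCast.2
        (Nat.div_dvd_div_left hl (Nat.dvd_lcm_right a b)))⟩
  have hfin : (∑ e ∈ U S, φ e) * (∑ e ∈ U T, φ e) ≤ N * ∑ e ∈ U (S ∪ T), φ e :=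
    four.trans (Nat.mul_le_mul hinf hsup)
  have hreal : (N * d₁) * (N * d₂) ≤ N * (N * d) := by
    rw [key S Finset.subset_union_left d₁ h₁, key T Finset.subset_union_right d₂ h₂,
      key (S ∪ T) subset_rfl d h]
    exact_mod_cast hfin
  have hN' : (0 : ℝ) < N := by exact_mod_cast hN
  have h3 : (N * N : ℝ) * (d₁ * d₂) ≤ (N * N) * d := by linarith
  exact le_of_mul_le_mul_left h3 (by positivity)

theorem hasLogDensity_mul_le {C₁ C₂ : Set ℕ} (h₁ : ∀ c ∈ C₁, 0 < c) (h₂ : ∀ c ∈ C₂, 0 < c)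
    {d₁ d₂ d : ℝ} (hd₁ : HasLogDensity (free C₁) d₁) (hd₂ : HasLogDensity (free C₂) d₂)
    (hd : HasLogDensity (free (C₁ ∪ C₂)) d) : d₁ * d₂ ≤ d := by
  classical
  obtain ⟨D, hD, happ⟩ := exists_hasLogDensity_free (C := C₁ ∪ C₂)
    fun c hc => hc.elim (h₁ c) (h₂ c)
  rw [hd.unique hD]
  refine le_of_forall_pos_lt_add fun ε hε => ?_
  obtain ⟨S, hSC, dS, hdS, hlt⟩ := happ ε hε
  refine lt_of_le_of_lt ?_ hlt
  set S₁ := S.filter (· ∈ C₁) with hS₁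
  set S₂ := S.filter (· ∈ C₂) with hS₂
  have hs₁ : (S₁ : Set ℕ) ⊆ C₁ := fun c hc => (Finset.mem_filter.1 (Finset.mem_coe.1 hc)).2
  have hs₂ : (S₂ : Set ℕ) ⊆ C₂ := fun c hc => (Finset.mem_filter.1 (Finset.mem_coe.1 hc)).2
  have hunion : S₁ ∪ S₂ = S := by
    rw [hS₁, hS₂, ← Finset.filter_or]
    exact Finset.filter_true_of_mem fun c hc => hSC hc
  obtain ⟨e₁, he₁⟩ := hasLogDensity_free_finset (S := S₁) fun c hc => h₁ c (hs₁ hc)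
  obtain ⟨e₂, he₂⟩ := hasLogDensity_free_finset (S := S₂) fun c hc => h₂ c (hs₂ hc)
  rw [← hunion] at hdS
  have := hasLogDensity_mul_le_of_finset (fun c hc => h₁ c (hs₁ hc)) (fun c hc => h₂ c (hs₂ hc))
    he₁ he₂ hdS
  refine le_trans ?_ this
  exact mul_le_mul (hd₁.mono he₁ (free_anti hs₁)) (hd₂.mono he₂ (free_anti hs₂)) hd₂.nonneg
    he₁.nonneg

/-! ### Behrend sets -/

/-- `C` is a Behrend set: almost all integers, in the sense of logarithmic density, are multiples
of an element of `C`. -/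
def IsBehrend (C : Set ℕ) : Prop :=
  HasLogDensity (free C) 0

/-- By the correlation inequality the two densities of free integers have product 0. -/
theorem isBehrend_or_of_union {C₁ C₂ : Set ℕ} (h₁ : ∀ c ∈ C₁, 0 < c) (h₂ : ∀ c ∈ C₂, 0 < c)
    (h : IsBehrend (C₁ ∪ C₂)) : IsBehrend C₁ ∨ IsBehrend C₂ := by
  obtain ⟨d₁, hd₁, -⟩ := exists_hasLogDensity_free h₁
  obtain ⟨d₂, hd₂, -⟩ := exists_hasLogDensity_free h₂
  have h0 := hasLogDensity_mul_le h₁ h₂ hd₁ hd₂ h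
  have h0' : d₁ * d₂ = 0 := le_antisymm h0 (mul_nonneg hd₁.nonneg hd₂.nonneg)
  rcases mul_eq_zero.1 h0' with rfl | rfl
  · exact Or.inl hd₁
  · exact Or.inr hd₂

theorem not_isBehrend_empty : ¬IsBehrend ∅ := fun h => by
  have : free ∅ = univ := by
    ext n
    simp [mem_free]
  rw [IsBehrend, this] at h
  exact zero_ne_one (h.unique hasLogDensity_univ)

theorem exists_isBehrend_of_biUnion {ι : Type*} (s : Finset ι) (C : ι → Set ℕ)
    (hC : ∀ i ∈ s, ∀ c ∈ C i, 0 < c) (h : IsBehrend (⋃ i ∈ s, C i)) :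
    ∃ i ∈ s, IsBehrend (C i) := by
  classical
  induction s using Finset.induction_on with
  | empty => exact absurd (by simpa using h) not_isBehrend_empty
  | insert i s hi ih =>
    rw [Finset.set_biUnion_insert] at h
    have hs : ∀ j ∈ s, ∀ c ∈ C j, 0 < c := fun j hj => hC j (by simp [hj])
    rcases isBehrend_or_of_union (hC i (by simp)) (fun c hc => by
      obtain ⟨j, hj, hc⟩ := mem_iUnion₂.1 hc
      exact hs j hj c hc) h with h | h
    · exact ⟨i, by simp, h⟩
    · obtain ⟨j, hj, h⟩ := ih hs h
      exact ⟨j, by simp [hj], h⟩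

/-- For a ≥ 2 the progression 1 + aℤ avoids the multiples of a, so {a} is not Behrend and the rest
must be. -/
theorem IsBehrend.diff_singleton {C : Set ℕ} (hC : ∀ c ∈ C, 0 < c) (h : IsBehrend C) {a : ℕ}
    (ha : a ∈ C) (ha2 : 2 ≤ a) : IsBehrend (C \ {a}) := by
  have hu : C = {a} ∪ C \ {a} := by
    rw [union_sdiff_self, union_eq_self_of_subset_left (singleton_subset_iff.2 ha)]
  rw [hu] at h
  refine (isBehrend_or_of_union (by simpa using hC a ha) (fun c hc => hC c hc.1) h).resolve_left
    fun h' => ?_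
  have hle := (hasLogDensity_modEq (hC a ha) 1).mono h' fun m hm => by
    rw [mem_free]
    rintro c rfl hc
    have h1 := dvd_sub hc hm
    rw [sub_sub_cancel] at h1
    have := Int.le_of_dvd one_pos h1
    omega
  have : (0 : ℝ) < 1 / a := by
    have := hC a ha
    positivity
  linarith

/-- Multiples of da lost by deleting da from B lie in d times the (A \ {a})-free integers, a set of
density 0. -/
theorem not_isTaut_of_isBehrend {B A : Set ℕ} {d : ℕ} (hd : 0 < d) (hA : ∀ a ∈ A, 2 ≤ a)
    (hB : ∀ a ∈ A, d * a ∈ B) (h : IsBehrend A) : ¬IsTaut B := by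
  intro hT
  obtain ⟨a, ha⟩ : A.Nonempty := by
    rw [nonempty_iff_ne_empty]
    rintro rfl
    exact not_isBehrend_empty h
  obtain ⟨e, e', he, he', hlt⟩ := hT _ (hB a ha)
  have hA' := h.diff_singleton (fun c hc => by have := hA c hc; omega) ha (hA a ha)
  have h0 := HasLogDensity.dilate hA' hd
  rw [zero_div] at h0
  have := he'.le_add he h0 fun n hn => by
    by_cases hn' : n ∈ multiples (B \ {d * a})
    · exact Or.inl hn'
    · right
      obtain ⟨b, hb, hbn⟩ := hn
      have hbe : b = d * a := by
        by_contra hc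
        exact hn' ⟨b, ⟨hb, hc⟩, hbn⟩
      obtain ⟨k, rfl⟩ := hbn
      refine ⟨a * k, ?_, by rw [hbe]; push_cast; ring⟩
      rw [mem_free]
      intro c hc hck
      refine hn' ⟨d * c, ⟨hB c hc.1, fun heq => hc.2 ?_⟩, ?_⟩
      · exact Nat.eq_of_mul_eq_mul_left hd heq
      · rw [hbe]
        push_cast
        rw [mul_assoc]
        exact mul_dvd_mul_left _ hck
  linarith

/-! ### Arithmetic progressions inside sets of multiples -/

theorem hasLogDensity_modEq_inter_free {S : Finset ℕ} (hS : ∀ c ∈ S, 0 < c) {l : ℕ} (hl : 0 < l)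
    (hSl : ∀ c ∈ S, Nat.Coprime c l) {d : ℝ} (hd : HasLogDensity (free (S : Set ℕ)) d) (r : ℤ) :
    HasLogDensity ({m | (l : ℤ) ∣ m - r} ∩ free (S : Set ℕ)) (d / l) := by
  classical
  set N := S.lcm id with hN
  have hN0 : 0 < N := finset_lcm_pos hS
  have hNl : Nat.Coprime N l := by
    have h1 : N ∣ ∏ c ∈ S, c := Finset.lcm_dvd fun c hc => Finset.dvd_prod_of_mem _ hc
    exact Nat.Coprime.coprime_dvd_left h1 (Nat.Coprime.prod_left hSl)
  have hfree : ∀ (k m : ℤ), m + N * k ∈ free (S : Set ℕ) ↔ m ∈ free (S : Set ℕ) := fun k =>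
    add_mem_free_iff fun c hc => Dvd.dvd.mul_right
      (Int.natCast_dvd_natCast.2 (Finset.dvd_lcm (f := id) (Finset.mem_coe.1 hc))) k
  have hex : ∃ e, HasLogDensity ({m | (l : ℤ) ∣ m - r} ∩ free (S : Set ℕ)) e := by
    refine ⟨_, hasLogDensity_of_periodic (Nat.mul_pos hN0 hl) fun m => ?_⟩
    simp only [mem_inter_iff, mem_ofPred_eq]
    push_cast
    rw [hfree, add_sub_right_comm, Int.dvd_add_left (dvd_mul_left _ _)]
  obtain ⟨e, he⟩ := hex
  obtain ⟨u, v, huv⟩ : IsCoprime (N : ℤ) l := Nat.isCoprime_iff_coprime.2 hNl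
  have hall : ∀ j : ℕ, HasLogDensity ({m | (l : ℤ) ∣ m - j} ∩ free (S : Set ℕ)) e := by
    intro j
    -- Since Nu ≡ 1 mod l, this shift carries the class of j to that of r; being a multiple of N, it
    -- preserves the S-free integers. Hence all l classes have equal density.
    have := he.shift (N * (u * (r - j)))
    refine (congrArg (HasLogDensity · e) ?_).mp this
    ext m
    simp only [mem_inter_iff, mem_ofPred_eq]
    rw [hfree]
    refine and_congr_left fun _ => ?_
    have : m + N * (u * (r - j)) - r = (m - j) - l * (v * (r - j)) := by
      linear_combination (r - j) * huv
    rw [this, dvd_sub_left (dvd_mul_right _ _)]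
  have hsum := hasLogDensity_biUnion (Finset.range l)
    (fun j : ℕ => {m | (l : ℤ) ∣ m - j} ∩ free (S : Set ℕ)) (fun _ => e) (fun j _ => hall j) ?_
  · have hu : (⋃ j ∈ Finset.range l, ({m | (l : ℤ) ∣ m - (j : ℕ)} ∩ free (S : Set ℕ))) =
        free (S : Set ℕ) := by
      refine subset_antisymm (iUnion₂_subset fun j _ => inter_subset_right) fun m hm => ?_
      have hl' : (0 : ℤ) < l := by exact_mod_cast hl
      refine mem_iUnion₂.2 ⟨(m % l).toNat, ?_, ?_, hm⟩
      · rw [Finset.mem_range]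
        have := Int.emod_lt_of_pos m hl'
        have := Int.emod_nonneg m hl'.ne'
        omega
      · rw [mem_ofPred_eq, Int.toNat_of_nonneg (Int.emod_nonneg m hl'.ne')]
        exact Int.dvd_self_sub_emod
    rw [hu] at hsum
    have h1 := hd.unique hsum
    rw [Finset.sum_const, Finset.card_range, nsmul_eq_mul] at h1
    have hl' : (l : ℝ) ≠ 0 := by exact_mod_cast hl.ne'
    rwa [h1, mul_div_cancel_left₀ _ hl']
  · intro i hi j hj hij
    refine disjoint_left.2 fun m hm hm' => hij ?_
    have h1 : (l : ℤ) ∣ i - j := by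
      have := dvd_sub hm'.1 hm.1
      rwa [sub_sub_sub_cancel_left] at this
    have hi' := Finset.mem_range.1 (Finset.mem_coe.1 hi)
    have hj' := Finset.mem_range.1 (Finset.mem_coe.1 hj)
    have := Int.eq_zero_of_abs_lt_dvd h1 (by rw [abs_lt]; omega)
    omega

/-- For finite S ⊆ C, the S-free part of the progression has density d/l and lies among the S-free
integers that are not C-free, of density d - D. The latter can be made arbitrarily small, which
forces D = 0. -/
theorem isBehrend_of_progression_subset {C : Set ℕ} (hC : ∀ c ∈ C, 0 < c) {l : ℕ} (hl : 0 < l)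
    (hCl : ∀ c ∈ C, Nat.Coprime c l) {r : ℤ} (h : {m | (l : ℤ) ∣ m - r} ⊆ multiples C) :
    IsBehrend C := by
  obtain ⟨D, hD, happ⟩ := exists_hasLogDensity_free hC
  have hl' : (0 : ℝ) < l := by exact_mod_cast hl
  suffices D ≤ 0 by
    rw [IsBehrend, ← le_antisymm this hD.nonneg]
    exact hD
  have hDl : D / l ≤ 0 := by
    refine le_of_forall_pos_lt_add fun ε hε => ?_
    obtain ⟨S, hSC, d, hd, hlt⟩ := happ ε hε
    have h1 := hasLogDensity_modEq_inter_free (fun c hc => hC c (hSC hc)) hl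
      (fun c hc => hCl c (hSC hc)) hd r
    have h2 := h1.mono (hd.diff hD (free_anti hSC)) fun m hm =>
      ⟨hm.2, fun hm' => hm' (h hm.1)⟩
    have h3 : D / l ≤ d / l := by
      have := hD.mono hd (free_anti hSC)
      gcongr
    linarith
  rwa [div_le_iff₀ hl', zero_mul] at hDl

/-- If `B` is taut, then an arithmetic progression consists of multiples of elements of `B` only
if it consists of multiples of one element of `B`. -/
theorem IsTaut.exists_dvd_of_progression {B : Set ℕ} (hpos : ∀ b ∈ B, 0 < b) (hB : IsTaut B)
    {L : ℕ} (hL : 0 < L) {n : ℤ} (h : ∀ k : ℤ, n + L * k ∈ multiples B) :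
    ∃ b ∈ B, b ∣ L ∧ (b : ℤ) ∣ n := by
  by_contra! hcon
  set g := Int.gcd n L with hg
  have hg0 : 0 < g := Int.gcd_pos_of_ne_zero_right n (by exact_mod_cast hL.ne')
  obtain ⟨r, hr⟩ : (g : ℤ) ∣ n := Int.gcd_dvd_left _ _
  obtain ⟨l, hlg⟩ : g ∣ L := Int.natCast_dvd_natCast.1 (Int.gcd_dvd_right _ _)
  have hl : 0 < l := by
    rcases Nat.eq_zero_or_pos l with h0 | h0
    · rw [h0, mul_zero] at hlg
      omega
    · exact h0
  have hgz : (g : ℤ) ≠ 0 := by exact_mod_cast hg0.ne'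
  have hrl : IsCoprime r l := by
    rw [Int.isCoprime_iff_gcd_eq_one]
    have h1 : Int.gcd n L = g * Int.gcd r l := by
      conv_lhs => rw [hr, hlg]
      push_cast
      rw [Int.gcd_mul_left]
      simp
    rw [← hg] at h1
    exact (Nat.eq_of_mul_eq_mul_left hg0 (by rw [mul_one]; exact h1)).symm
  -- The progression is g(r + lℤ) with r coprime to l. If b divides gm, then c = b / gcd(b, g)
  -- divides m and is coprime to l; c = 1 would make b a divisor of both L and n. So each m ≡ r mod
  -- l is a multiple of some c in one of finitely many sets `A d`.
  let A : ℕ → Set ℕ := fun d => {c | 2 ≤ c ∧ d * c ∈ B ∧ Nat.Coprime c l}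
  have hApos : ∀ d ∈ g.divisors, ∀ c ∈ A d, 0 < c := fun d _ c hc => by
    have := hc.1
    omega
  have hsub : {m | (l : ℤ) ∣ m - r} ⊆ multiples (⋃ d ∈ g.divisors, A d) := by
    rintro m ⟨k, hk⟩
    have hmr : m = r + l * k := by linarith
    obtain ⟨b, hb, hbn⟩ := h k
    have hbm : (b : ℤ) ∣ g * m := by
      have : n + L * k = g * m := by
        rw [hr, hlg, hmr]
        push_cast
        ring
      rwa [this] at hbn
    set d := Nat.gcd b g with hd
    have hd0 : 0 < d := Nat.gcd_pos_of_pos_right _ hg0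
    obtain ⟨c, hc⟩ : d ∣ b := Nat.gcd_dvd_left _ _
    obtain ⟨e, he⟩ : d ∣ g := Nat.gcd_dvd_right _ _
    have hce : Nat.Coprime c e := by
      have h1 := Nat.coprime_div_gcd_div_gcd (m := b) (n := g) hd0
      rwa [← hd, Nat.div_eq_of_eq_mul_right hd0 hc, Nat.div_eq_of_eq_mul_right hd0 he] at h1
    have hcm : (c : ℤ) ∣ m := by
      have h1 : (d : ℤ) * c ∣ d * (e * m) := by
        rw [hc, he] at hbm
        push_cast at hbm
        rwa [mul_assoc] at hbm
      have h2 := (mul_dvd_mul_iff_left (by exact_mod_cast hd0.ne' : (d : ℤ) ≠ 0)).1 h1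
      exact (Nat.isCoprime_iff_coprime.2 hce).dvd_of_dvd_mul_left h2
    have hcop : Nat.Coprime c l := by
      rw [← Nat.isCoprime_iff_coprime]
      refine IsCoprime.of_isCoprime_of_dvd_left ?_ hcm
      rw [hmr]
      exact hrl.add_mul_left_left k
    refine ⟨c, mem_iUnion₂.2 ⟨d, Nat.mem_divisors.2 ⟨⟨e, he⟩, hg0.ne'⟩, ?_, ?_, hcop⟩, hcm⟩
    · by_contra hc2
      have hb0 := hpos b hb
      have hc1 : c = 1 := by
        have : c ≠ 0 := by
          rintro rfl
          omega
        omega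
      have hbg : b ∣ g := by
        rw [hc, hc1, mul_one]
        exact ⟨e, he⟩
      exact hcon b hb (hbg.trans ⟨l, hlg⟩) ((Int.natCast_dvd_natCast.2 hbg).trans ⟨r, hr⟩)
    · rw [← hc]
      exact hb
  have hBeh := isBehrend_of_progression_subset (fun c hc => by
    obtain ⟨d, hd, hc⟩ := mem_iUnion₂.1 hc
    exact hApos d hd c hc) hl (fun c hc => by
    obtain ⟨d, -, hc⟩ := mem_iUnion₂.1 hc
    exact hc.2.2) hsub
  obtain ⟨d, hd, hA⟩ := exists_isBehrend_of_biUnion _ A hApos hBeh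
  exact not_isTaut_of_isBehrend (Nat.pos_of_mem_divisors hd) (fun a ha => ha.1)
    (fun a ha => ha.2.1) hA hB

/-! ### Sets without scaled infinite pairwise coprime subsets are taut -/

theorem infinite_range_of_coprime_seq {f : ℕ → ℕ} (h2 : ∀ n, 2 ≤ f n)
    (hf : ∀ m n, m < n → Nat.Coprime (f m) (f n)) :
    (range f).Infinite ∧ (range f).Pairwise Nat.Coprime := by
  have hne : ∀ m n, m ≠ n → Nat.Coprime (f m) (f n) := fun m n hmn =>
    (lt_or_gt_of_ne hmn).elim (hf m n) fun h => (hf n m h).symm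
  constructor
  · refine infinite_range_of_injective fun m n hmn => ?_
    by_contra hc
    have h1 := hne m n hc
    rw [hmn, Nat.coprime_self] at h1
    have := h2 n
    omega
  · rintro _ ⟨m, rfl⟩ _ ⟨n, rfl⟩ h
    exact hne m n fun hmn => h (congrArg f hmn)

/-- Otherwise a pairwise coprime sequence could be built greedily, each new term coprime to the
product of the earlier ones. -/
theorem NoCoprimeScaling.exists_not_coprime {B : Set ℕ} (h : NoCoprimeScaling B) {d : ℕ}
    (hd : 0 < d) : ∃ Q, 0 < Q ∧ ∀ a, 2 ≤ a → d * a ∈ B → ¬Nat.Coprime a Q := by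
  by_contra! hcon
  obtain ⟨f, hf, hfr⟩ := exists_seq_of_forall_finset_exists (fun a => 2 ≤ a ∧ d * a ∈ B)
    Nat.Coprime fun s hs => by
      obtain ⟨a, ha2, haB, hac⟩ := hcon (∏ x ∈ s, x) (Finset.prod_pos fun x hx => by
        have := (hs x hx).1
        omega)
      exact ⟨a, ⟨ha2, haB⟩, fun x hx =>
        (Nat.Coprime.coprime_dvd_right (Finset.dvd_prod_of_mem _ hx) hac).symm⟩
  obtain ⟨h1, h2⟩ := infinite_range_of_coprime_seq (fun n => (hf n).1) hfr
  refine h ⟨d, range f, hd, ?_, h1, h2, ?_⟩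
  · rintro _ ⟨n, rfl⟩
    exact (hf n).1
  · rintro _ ⟨n, rfl⟩
    exact (hf n).2

theorem exists_hasLogDensity_multiples {C : Set ℕ} (hC : ∀ c ∈ C, 0 < c) :
    ∃ d, HasLogDensity (multiples C) d := by
  obtain ⟨D, hD, -⟩ := exists_hasLogDensity_free hC
  exact ⟨1 - D, compl_free C ▸ hD.compl⟩

theorem NoCoprimeScaling.isTaut {B : Set ℕ} (hpos : ∀ b ∈ B, 0 < b) (hprim : IsPrimitive B)
    (h : NoCoprimeScaling B) : IsTaut B := by
  intro b hb
  have hb0 := hpos b hb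
  obtain ⟨d, hd⟩ := exists_hasLogDensity_multiples (C := B \ {b}) fun c hc => hpos c hc.1
  obtain ⟨d', hd'⟩ := exists_hasLogDensity_multiples hpos
  refine ⟨d, d', hd, hd', ?_⟩
  -- For q the product of the obstructions over all divisors e of b, the progression b + bqℤ avoids
  -- the multiples of the other elements. If c divides b(1 + qk) and e = gcd(c, b), then c/e ≥ 2 by
  -- primitivity, and c/e is coprime to q, against the choice of `Q e`. So b adds at least 1/(bq) to
  -- the density.
  choose Q hQ0 hQ using fun e : b.divisors => h.exists_not_coprime (Nat.pos_of_mem_divisors e.2)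
  set q := ∏ e, Q e with hq
  have hq0 : 0 < q := Finset.prod_pos fun e _ => hQ0 e
  have hmod := hasLogDensity_modEq (Nat.mul_pos hb0 hq0) b
  have hdisj : Disjoint (multiples (B \ {b})) {m : ℤ | ((b * q : ℕ) : ℤ) ∣ m - b} := by
    refine disjoint_left.2 ?_
    rintro m ⟨c, ⟨hcB, hcb⟩, hcm⟩ ⟨k, hk⟩
    have hm : m = b * (1 + q * k) := by
      push_cast at hk
      linear_combination hk
    have hc0 := hpos c hcB
    set e := Nat.gcd c b with he
    have he0 : 0 < e := Nat.gcd_pos_of_pos_right _ hb0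
    obtain ⟨a, ha⟩ : e ∣ c := Nat.gcd_dvd_left _ _
    obtain ⟨b', hb'⟩ : e ∣ b := Nat.gcd_dvd_right _ _
    have ha2 : 2 ≤ a := by
      have h0 : a ≠ 0 := by
        rintro rfl
        omega
      have h1 : a ≠ 1 := by
        rintro rfl
        refine hcb (hprim c hcB b hb ?_)
        rw [ha, mul_one]
        exact ⟨b', hb'⟩
      omega
    have hab' : Nat.Coprime a b' := by
      have h1 := Nat.coprime_div_gcd_div_gcd (m := c) (n := b) he0
      rwa [← he, Nat.div_eq_of_eq_mul_right he0 ha, Nat.div_eq_of_eq_mul_right he0 hb'] at h1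
    have ham : (a : ℤ) ∣ 1 + q * k := by
      have h1 : (e : ℤ) * a ∣ e * (b' * (1 + q * k)) := by
        rw [hm, ha, hb'] at hcm
        push_cast at hcm
        rwa [mul_assoc] at hcm
      have h2 := (mul_dvd_mul_iff_left (by exact_mod_cast he0.ne' : (e : ℤ) ≠ 0)).1 h1
      exact (Nat.isCoprime_iff_coprime.2 hab').dvd_of_dvd_mul_left h2
    have hcop : Nat.Coprime a q := by
      rw [← Nat.isCoprime_iff_coprime]
      refine IsCoprime.of_isCoprime_of_dvd_left ?_ ham
      exact isCoprime_one_left.add_mul_left_left k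
    have hediv : e ∈ b.divisors := Nat.mem_divisors.2 ⟨⟨b', hb'⟩, hb0.ne'⟩
    exact hQ ⟨e, hediv⟩ a ha2 (by rw [← ha]; exact hcB)
      (Nat.Coprime.coprime_dvd_right (Finset.dvd_prod_of_mem Q (Finset.mem_univ _)) hcop)
  have hle := (hd.union hmod hdisj).mono hd' ?_
  · have : (0 : ℝ) < 1 / ((b * q : ℕ) : ℝ) := by
      have := Nat.mul_pos hb0 hq0
      positivity
    linarith
  · refine union_subset ?_ ?_
    · rintro m ⟨c, hc, hcm⟩
      exact ⟨c, hc.1, hcm⟩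
    · intro m hm
      refine ⟨b, hb, ?_⟩
      have h1 : (b : ℤ) ∣ m - b := by
        refine dvd_trans ?_ hm
        push_cast
        exact dvd_mul_right _ _
      exact (dvd_sub_self_right).1 h1

/-! ### The topology of `H` -/

variable {B : Set ℕ}

/-- The set of points of `H` with the same coordinates as `h` in a set `S`. -/
def cylinder (S : Finset ℕ) (h : H B) : Set (H B) :=
  {h' | ∀ b : B, (b : ℕ) ∈ S → (h' : ∀ b : B, ZMod (b : ℕ)) b = (h : ∀ b : B, ZMod (b : ℕ)) b}

theorem mem_cylinder_self (S : Finset ℕ) (h : H B) : h ∈ cylinder S h :=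
  fun _ _ => rfl

theorem continuous_coord (b : B) :
    Continuous fun h : H B => (h : ∀ b : B, ZMod (b : ℕ)) b :=
  (continuous_apply b).comp continuous_subtype_val

theorem isOpen_cylinder (S : Finset ℕ) (h : H B) : IsOpen (cylinder S h) := by
  have hfin : {b : B | (b : ℕ) ∈ S}.Finite :=
    S.finite_toSet.preimage Subtype.val_injective.injOn
  have : cylinder S h = ⋂ b ∈ {b : B | (b : ℕ) ∈ S},
      {h' : H B | (h' : ∀ b : B, ZMod (b : ℕ)) b = (h : ∀ b : B, ZMod (b : ℕ)) b} := by
    ext h'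
    simp [cylinder]
  rw [this]
  exact hfin.isOpen_biInter fun b _ => (isOpen_discrete {_}).preimage (continuous_coord b)

theorem exists_cylinder_subset {h : H B} {U : Set (H B)} (hU : U ∈ 𝓝 h) :
    ∃ S : Finset ℕ, (S : Set ℕ) ⊆ B ∧ cylinder S h ⊆ U := by
  classical
  rw [nhds_subtype, mem_comap] at hU
  obtain ⟨V, hV, hVU⟩ := hU
  obtain ⟨V', hV'V, hV'o, hhV'⟩ := mem_nhds_iff.1 hV
  obtain ⟨I, u, hu, hsub⟩ := isOpen_pi_iff.1 hV'o _ hhV'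
  refine ⟨I.image Subtype.val, ?_, fun h' hh' => hVU (hV'V (hsub fun b hb => ?_))⟩
  · intro b hb
    obtain ⟨b', -, rfl⟩ := Finset.mem_image.1 (Finset.mem_coe.1 hb)
    exact b'.2
  · rw [hh' b (Finset.mem_image_of_mem _ hb)]
    exact (hu b hb).2

theorem denseRange_Δ : DenseRange (Δ B) := by
  intro h
  rw [closure_subtype]
  refine closure_mono ?_ h.2
  rintro _ ⟨n, rfl⟩
  exact ⟨Δ B n, ⟨n, rfl⟩, rfl⟩

theorem exists_Δ_mem_cylinder (S : Finset ℕ) (h : H B) : ∃ n : ℤ, Δ B n ∈ cylinder S h :=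
  denseRange_Δ.exists_mem_open (isOpen_cylinder S h) ⟨h, mem_cylinder_self S h⟩

theorem Δ_apply (n : ℤ) (b : B) : (Δ B n : ∀ b : B, ZMod (b : ℕ)) b = (n : ZMod (b : ℕ)) :=
  rfl

theorem intCast_lcm_dvd_iff {S : Finset ℕ} {k : ℤ} :
    ((S.lcm id : ℕ) : ℤ) ∣ k ↔ ∀ b ∈ S, (b : ℤ) ∣ k := by
  simp only [Int.natCast_dvd, Finset.lcm_dvd_iff, id]

theorem Δ_mem_cylinder_Δ {S : Finset ℕ} (hS : (S : Set ℕ) ⊆ B) {m n : ℤ} :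
    Δ B m ∈ cylinder S (Δ B n) ↔ ((S.lcm id : ℕ) : ℤ) ∣ n - m := by
  rw [intCast_lcm_dvd_iff]
  constructor
  · intro h b hb
    have := h ⟨b, hS hb⟩ hb
    rwa [Δ_apply, Δ_apply, ZMod.intCast_eq_intCast_iff_dvd_sub] at this
  · intro h b hb
    rw [Δ_apply, Δ_apply, ZMod.intCast_eq_intCast_iff_dvd_sub]
    exact h b hb

theorem Δ_mem_window {n : ℤ} : Δ B n ∈ window B ↔ n ∈ free B := by
  rw [mem_free]
  constructor
  · intro h b hb hd
    exact h ⟨b, hb⟩ (by rw [Δ_apply, ZMod.intCast_zmod_eq_zero_iff_dvd]; exact hd)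
  · intro h b hb
    rw [Δ_apply, ZMod.intCast_zmod_eq_zero_iff_dvd] at hb
    exact h b b.2 hb

theorem isClosed_window : IsClosed (window B) := by
  have : window B = ⋂ b : B, {h : H B | (h : ∀ b : B, ZMod (b : ℕ)) b ≠ 0} := by
    ext h
    simp [window]
  rw [this]
  exact isClosed_iInter fun b =>
    (isClosed_discrete {x : ZMod (b : ℕ) | x ≠ 0}).preimage (continuous_coord b)

/-- By Bézout, n + lcm(S)ℤ contains a multiple of b exactly when gcd(b, lcm(S)) divides n. Density
of Δ(ℤ) carries this over to all points of the cylinder. -/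
theorem cylinder_Δ_subset_window_iff {S : Finset ℕ} (hS : (S : Set ℕ) ⊆ B) {n : ℤ} :
    cylinder S (Δ B n) ⊆ window B ↔ n ∈ free (gcdSet B S) := by
  classical
  constructor
  · intro h
    rw [mem_free]
    rintro _ ⟨b, hb, rfl⟩ hd
    obtain ⟨x, y, hxy⟩ := Int.gcd_dvd_iff.1
      (show Int.gcd (b : ℤ) ((S.lcm id : ℕ) : ℤ) ∣ n.natAbs from by
        rw [Int.gcd_natCast_natCast]
        exact Int.natCast_dvd.1 hd)
    have hgcd : ∃ x y : ℤ, n = b * x + (S.lcm id : ℕ) * y := by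
      rcases Int.natAbs_eq n with hn | hn
      · exact ⟨x, y, by rw [hn]; exact hxy⟩
      · refine ⟨-x, -y, ?_⟩
        rw [hn, hxy]
        ring
    obtain ⟨x, y, hxy⟩ := hgcd
    have hm : Δ B (b * x) ∈ cylinder S (Δ B n) := by
      rw [Δ_mem_cylinder_Δ hS, hxy, add_sub_cancel_left]
      exact dvd_mul_right _ _
    exact (mem_free.1 (Δ_mem_window.1 (h hm))) b hb (dvd_mul_right _ _)
  · intro h h' hh' b hb
    obtain ⟨m, hm⟩ := exists_Δ_mem_cylinder (insert (b : ℕ) S) h'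
    have hbm : (b : ℤ) ∣ m := by
      have := hm b (Finset.mem_insert_self _ _)
      rw [hb, Δ_apply, ZMod.intCast_zmod_eq_zero_iff_dvd] at this
      exact this
    have hmn : ((S.lcm id : ℕ) : ℤ) ∣ n - m := by
      rw [← Δ_mem_cylinder_Δ hS]
      intro c hc
      rw [hm c (Finset.mem_insert_of_mem hc), hh' c hc]
    refine mem_free.1 h _ ⟨b, b.2, rfl⟩ ?_
    have h1 : ((Nat.gcd b (S.lcm id) : ℕ) : ℤ) ∣ m :=
      (Int.natCast_dvd_natCast.2 (Nat.gcd_dvd_left _ _)).trans hbm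
    have h2 : ((Nat.gcd b (S.lcm id) : ℕ) : ℤ) ∣ n - m :=
      (Int.natCast_dvd_natCast.2 (Nat.gcd_dvd_right _ _)).trans hmn
    simpa using dvd_add h2 h1

theorem Δ_mem_interior_window {n : ℤ} :
    Δ B n ∈ interior (window B) ↔
      ∃ S : Finset ℕ, (S : Set ℕ) ⊆ B ∧ n ∈ free (gcdSet B S) := by
  rw [mem_interior_iff_mem_nhds]
  constructor
  · intro h
    obtain ⟨S, hS, hsub⟩ := exists_cylinder_subset h
    exact ⟨S, hS, (cylinder_Δ_subset_window_iff hS).1 hsub⟩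
  · rintro ⟨S, hS, hn⟩
    exact mem_of_superset ((isOpen_cylinder S _).mem_nhds (mem_cylinder_self S _))
      ((cylinder_Δ_subset_window_iff hS).2 hn)

theorem freeEqUnion_iff :
    FreeEqUnion B ↔ ∀ n : ℤ, Δ B n ∈ window B → Δ B n ∈ interior (window B) := by
  unfold FreeEqUnion
  simp only [Δ_mem_interior_window, Δ_mem_window]
  constructor
  · intro h n hn
    rw [h] at hn
    exact hn
  · intro h
    refine subset_antisymm h ?_
    rintro n ⟨S, hS, hn⟩
    exact Δ_mem_window.1 ((cylinder_Δ_subset_window_iff hS).2 hn (mem_cylinder_self S _))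

/-! ### The coding function -/

theorem coding_eq_one_iff {h : H B} {n : ℤ} : coding B h n = 1 ↔ h + Δ B n ∈ window B := by
  unfold coding
  split_ifs with hw <;> simp [hw]

theorem coding_eq_zero_iff {h : H B} {n : ℤ} : coding B h n = 0 ↔ h + Δ B n ∉ window B := by
  unfold coding
  split_ifs with hw <;> simp [hw]

theorem η_eq_coding : η B = coding B 0 := by
  funext n
  by_cases hn : n ∈ free B
  · rw [coding_eq_one_iff.2 (by rwa [zero_add, Δ_mem_window])]
    exact if_pos hn
  · rw [coding_eq_zero_iff.2 (by rwa [zero_add, Δ_mem_window])]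
    exact if_neg hn

theorem η_eq_one_iff {n : ℤ} : η B n = 1 ↔ n ∈ free B := by
  rw [η_eq_coding, coding_eq_one_iff, zero_add, Δ_mem_window]

theorem η_eq_zero_iff {n : ℤ} : η B n = 0 ↔ n ∉ free B := by
  rw [η_eq_coding, coding_eq_zero_iff, zero_add, Δ_mem_window]

theorem shift_coding (n : ℤ) (h : H B) : shift n (coding B h) = coding B (h + Δ B n) := by
  funext m
  have h' : h + Δ B (m + n) = h + Δ B n + Δ B m := by
    rw [add_comm m n, map_add, add_assoc]
  change coding B h (m + n) = coding B (h + Δ B n) m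
  by_cases hw : h + Δ B (m + n) ∈ window B
  · rw [coding_eq_one_iff.2 hw, coding_eq_one_iff.2 (h' ▸ hw)]
  · rw [coding_eq_zero_iff.2 hw, coding_eq_zero_iff.2 (h' ▸ hw)]

theorem one_notMem_of_isPrimitive (hone : B ≠ {1}) (hprim : IsPrimitive B) : 1 ∉ B := by
  refine fun h1 => hone (subset_antisymm (fun b hb => ?_) (singleton_subset_iff.2 h1))
  exact (hprim 1 h1 b hb (one_dvd b)).symm

theorem η_one (h1 : 1 ∉ B) : η B 1 = 1 := by
  rw [η_eq_one_iff, mem_free]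
  intro b hb hd
  have : b = 1 := Nat.dvd_one.1 (by exact_mod_cast hd)
  exact h1 (this ▸ hb)

theorem η_ne_zero (h1 : 1 ∉ B) : η B ≠ 0 := fun h => by
  have := η_one h1
  rw [h] at this
  exact absurd this (by simp)

theorem η_zero (hne : B.Nonempty) : η B 0 = 0 := by
  rw [η_eq_zero_iff, notMem_free]
  obtain ⟨b, hb⟩ := hne
  exact ⟨b, hb, dvd_zero _⟩

/-! ### The equivalence of the arithmetic properties -/

theorem continuousAt_coding_zero_iff : ContinuousAt (coding B) 0 ↔ FreeEqUnion B := by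
  rw [freeEqUnion_iff, continuousAt_pi]
  refine forall_congr' fun n => ?_
  have htend : Tendsto (fun h : H B => h + Δ B n) (𝓝 0) (𝓝 (Δ B n)) := by
    have : Continuous fun h : H B => h + Δ B n := by fun_prop
    simpa using this.tendsto 0
  constructor
  · intro hc hn
    have h1 : ∀ᶠ h : H B in 𝓝 0, coding B h n = 1 := by
      have : coding B 0 n = 1 := by rwa [coding_eq_one_iff, zero_add]
      have h2 := hc.eventually ((isOpen_discrete {(1 : Fin 2)}).mem_nhds this)
      exact h2
    rw [mem_interior_iff_mem_nhds]
    have htend' : Tendsto (fun h : H B => h - Δ B n) (𝓝 (Δ B n)) (𝓝 0) := by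
      have : Continuous fun h : H B => h - Δ B n := by fun_prop
      simpa using this.tendsto (Δ B n)
    filter_upwards [htend'.eventually h1] with h hh
    rwa [coding_eq_one_iff, sub_add_cancel] at hh
  · intro hn
    have key : ∀ᶠ h : H B in 𝓝 0, coding B h n = coding B 0 n := by
      by_cases hw : Δ B n ∈ window B
      · filter_upwards [htend.eventually (mem_interior_iff_mem_nhds.1 (hn hw))] with h hh
        rw [coding_eq_one_iff.2 hh, coding_eq_one_iff.2 (by rwa [zero_add])]
      · filter_upwards [htend.eventually (isClosed_window.isOpen_compl.mem_nhds hw)] with h hh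
        rw [coding_eq_zero_iff.2 hh, coding_eq_zero_iff.2 (by rwa [zero_add])]
    exact (tendsto_const_nhds).congr' (key.mono fun _ h => h.symm)

/-- gcd(b, p) takes finitely many values; one b is chosen for each. This converts a period p of η
into a finite S. -/
theorem exists_finset_gcd_dvd_lcm {p : ℕ} (hp : 0 < p) :
    ∃ S : Finset ℕ, (S : Set ℕ) ⊆ B ∧ ∀ b ∈ B, Nat.gcd b p ∣ S.lcm id := by
  classical
  have hfin : (range fun b : B => Nat.gcd b p).Finite :=
    p.divisors.finite_toSet.subset (by
      rintro _ ⟨b, rfl⟩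
      exact Nat.mem_divisors.2 ⟨Nat.gcd_dvd_right _ _, hp.ne'⟩)
  have hex : ∀ d ∈ range fun b : B => Nat.gcd b p, ∃ b : ℕ, b ∈ B ∧ Nat.gcd b p = d := by
    rintro _ ⟨b, rfl⟩
    exact ⟨b, b.2, rfl⟩
  choose! f hfB hf using hex
  refine ⟨hfin.toFinset.image f, ?_, fun b hb => ?_⟩
  · intro b hb
    obtain ⟨d, hd, rfl⟩ := Finset.mem_image.1 (Finset.mem_coe.1 hb)
    exact hfB d (hfin.mem_toFinset.1 hd)
  · have hd : Nat.gcd b p ∈ range fun b : B => Nat.gcd b p := ⟨⟨b, hb⟩, rfl⟩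
    have h1 : Nat.gcd b p ∣ f (Nat.gcd b p) := by
      conv_lhs => rw [← hf _ hd]
      exact Nat.gcd_dvd_left _ _
    exact h1.trans (Finset.dvd_lcm (f := id)
      (Finset.mem_image_of_mem _ (hfin.mem_toFinset.2 hd)))

theorem isToeplitz_η_iff (hpos : ∀ b ∈ B, 0 < b) : IsToeplitz (η B) ↔ FreeEqUnion B := by
  rw [freeEqUnion_iff]
  simp only [Δ_mem_interior_window, Δ_mem_window]
  constructor
  · intro hT n hn
    obtain ⟨p, hp, hpn⟩ := hT n
    obtain ⟨S, hS, hSp⟩ := exists_finset_gcd_dvd_lcm (B := B) hp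
    refine ⟨S, hS, mem_free.2 ?_⟩
    rintro _ ⟨b, hb, rfl⟩ hd
    -- If gcd(b, lcm(S)) divided n, so would gcd(b, p). Then b would divide some n + jp, where η is
    -- 1 by periodicity.
    have h1 : Nat.gcd b p ∣ Nat.gcd b (S.lcm id) := Nat.dvd_gcd (Nat.gcd_dvd_left _ _) (hSp b hb)
    have h2 : ((Int.gcd b p : ℕ) : ℤ) ∣ n := by
      rw [Int.gcd_natCast_natCast]
      exact (Int.natCast_dvd_natCast.2 h1).trans hd
    obtain ⟨k, hk⟩ := h2
    have hbez := Int.gcd_eq_gcd_ab (b : ℤ) p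
    have h3 := hpn (-(Int.gcdB b p * k))
    rw [η_eq_one_iff.2 hn, η_eq_one_iff, mem_free] at h3
    refine h3 b hb ⟨Int.gcdA b p * k, ?_⟩
    rw [hk, hbez]
    ring
  · intro h n
    by_cases hn : n ∈ free B
    · obtain ⟨S, hS, hnS⟩ := h n hn
      refine ⟨S.lcm id, finset_lcm_pos fun c hc => hpos c (hS hc), fun j => ?_⟩
      rw [η_eq_one_iff.2 hn, η_eq_one_iff, ← Δ_mem_window]
      refine (cylinder_Δ_subset_window_iff hS).2 hnS ?_
      rw [Δ_mem_cylinder_Δ hS, sub_add_cancel_left, dvd_neg]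
      exact dvd_mul_left _ _
    · obtain ⟨b, hb, hd⟩ := notMem_free.1 hn
      refine ⟨b, hpos b hb, fun j => ?_⟩
      rw [η_eq_zero_iff.2 hn, η_eq_zero_iff, notMem_free]
      exact ⟨b, hb, dvd_add hd (dvd_mul_left _ _)⟩

theorem freeEqUnion_of_gcdSetInfEmpty (hne : B.Nonempty) (h : GcdSetInfEmpty B) :
    FreeEqUnion B := by
  classical
  rw [freeEqUnion_iff]
  simp only [Δ_mem_interior_window, Δ_mem_window]
  intro n hn
  by_contra! hcon
  have hn0 : n ≠ 0 := by
    rintro rfl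
    obtain ⟨b, hb⟩ := hne
    exact mem_free.1 hn b hb (dvd_zero _)
  have hdiv : ∀ S : Finset ℕ, (S : Set ℕ) ⊆ B → ∃ a ∈ gcdSet B S, (a : ℤ) ∣ n := fun S hS =>
    notMem_free.1 (hcon S hS)
  have hnotin : ∀ a ∈ n.natAbs.divisors, ∃ S : Finset ℕ, (S : Set ℕ) ⊆ B ∧
      ∀ S' : Finset ℕ, (S' : Set ℕ) ⊆ B → S ⊆ S' → a ∉ gcdSet B S' := by
    intro a ha
    have ha0 : 0 < a := Nat.pos_of_mem_divisors ha
    have han : (a : ℤ) ∣ n := Int.natCast_dvd.2 (Nat.dvd_of_mem_divisors ha)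
    by_contra! hc
    have hmem : a ∈ gcdSetInf B := by
      refine ⟨ha0, fun S hS => ?_⟩
      obtain ⟨S', hS', hSS', haS'⟩ := hc S hS
      -- The condition a ∉ S' is automatic: a divides the B-free number n, so a ∉ B.
      exact ⟨S', hS', hSS', haS', fun h' => mem_free.1 hn a (hS' h') han⟩
    rw [h] at hmem
    exact hmem
  choose! T hTB hT using hnotin
  set S := n.natAbs.divisors.biUnion T with hSdef
  have hSB : (S : Set ℕ) ⊆ B := by
    intro b hb
    obtain ⟨a, ha, hb⟩ := Finset.mem_biUnion.1 (Finset.mem_coe.1 hb)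
    exact hTB a ha hb
  obtain ⟨a, ha, han⟩ := hdiv S hSB
  have had : a ∈ n.natAbs.divisors :=
    Nat.mem_divisors.2 ⟨Int.natCast_dvd.1 han, Int.natAbs_ne_zero.2 hn0⟩
  exact hT a had S hSB (Finset.subset_biUnion_of_mem T had) ha

theorem gcdSetInfEmpty_of_noCoprimeScaling (hpos : ∀ b ∈ B, 0 < b) (h : NoCoprimeScaling B) : GcdSetInfEmpty B := by
  classical
  rw [GcdSetInfEmpty, eq_empty_iff_forall_notMem]
  rintro n ⟨hn0, hn⟩
  have hnB : n ∉ B := fun hnB => by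
    obtain ⟨S', -, hSS', -, hnS'⟩ := hn {n} (by simpa using hnB)
    exact hnS' (hSS' (Finset.mem_singleton_self n))
  obtain ⟨f, hf, hfr⟩ := exists_seq_of_forall_finset_exists (fun a => 2 ≤ a ∧ n * a ∈ B)
    Nat.Coprime fun s hs => by
      -- With n = gcd(b, lcm(S')) and S' containing every nx chosen so far, the next term is a =
      -- b/n: the number n·gcd(x, a) divides both b and nx, hence divides n.
      obtain ⟨S', hS', hSS', ⟨b, hb, hnb⟩, -⟩ := hn (s.image (n * ·)) (by
        intro b hb
        obtain ⟨a, ha, rfl⟩ := Finset.mem_image.1 (Finset.mem_coe.1 hb)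
        exact (hs a ha).2)
      obtain ⟨a, ha⟩ : n ∣ b := hnb ▸ Nat.gcd_dvd_left _ _
      refine ⟨a, ⟨?_, ha ▸ hb⟩, fun x hx => ?_⟩
      · have h1 : a ≠ 1 := by
          rintro rfl
          rw [mul_one] at ha
          exact hnB (ha ▸ hb)
        have h0 : a ≠ 0 := by
          rintro rfl
          exact (hpos b hb).ne' ha
        omega
      · have h1 : n * Nat.gcd x a ∣ n * 1 := by
          rw [mul_one]
          conv_rhs => rw [hnb]
          rw [← Nat.gcd_mul_left, ← ha, Nat.gcd_comm]
          exact Nat.gcd_dvd_gcd_of_dvd_right _ (Finset.dvd_lcm (f := id)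
            (hSS' (Finset.mem_image_of_mem _ hx)))
        exact Nat.dvd_one.1 (Nat.dvd_of_mul_dvd_mul_left hn0 h1)
  obtain ⟨h1, h2⟩ := infinite_range_of_coprime_seq (fun n => (hf n).1) hfr
  refine h ⟨n, range f, hn0, ?_, h1, h2, ?_⟩
  · rintro _ ⟨n, rfl⟩
    exact (hf n).1
  · rintro _ ⟨n, rfl⟩
    exact (hf n).2

theorem exists_coprime_of_infinite {A : Set ℕ} (hA : A.Infinite) (hcop : A.Pairwise Nat.Coprime)
    {L : ℕ} (hL : 0 < L) : ∃ a ∈ A, Nat.Coprime a L := by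
  classical
  by_contra! hcon
  have hp : ∀ a ∈ A, ∃ p, p.Prime ∧ p ∣ a ∧ p ∣ L := fun a ha =>
    Nat.Prime.not_coprime_iff_dvd.1 (hcon a ha)
  choose! f hf using hp
  refine hA (Finite.of_injOn (f := f) (t := (L.primeFactors : Set ℕ)) ?_ ?_
    (Finset.finite_toSet _))
  · intro a ha
    exact Nat.mem_primeFactors.2 ⟨(hf a ha).1, (hf a ha).2.2, hL.ne'⟩
  · intro a ha b hb hab
    by_contra hne
    have h1 := hcop ha hb hne
    have h2 := Nat.dvd_gcd (hf a ha).2.1 (hab ▸ (hf b hb).2.1)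
    rw [h1] at h2
    exact (hf a ha).1.one_lt.ne' (Nat.dvd_one.1 h2)

theorem gcd_mul_eq_of_coprime {d a L : ℕ} (h : Nat.Coprime a L) :
    Nat.gcd (d * a) L = Nat.gcd d L :=
  Nat.Coprime.gcd_mul_right_cancel d h

theorem notMem_of_scaling_subset (hprim : IsPrimitive B) {d : ℕ} (hd : 0 < d) {A : Set ℕ}
    (hA2 : ∀ a ∈ A, 2 ≤ a) (hA : A.Nonempty) (hAB : ∀ a ∈ A, d * a ∈ B) : (d : ℤ) ∈ free B := by
  rw [mem_free]
  intro b hb hbd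
  obtain ⟨a, ha⟩ := hA
  have h1 : b ∣ d := Int.natCast_dvd_natCast.1 hbd
  have h2 := hprim b hb _ (hAB a ha) (h1.mul_right a)
  have h3 := Nat.le_of_dvd hd h1
  have h4 := hA2 a ha
  nlinarith

theorem noCoprimeScaling_of_freeEqUnion (hpos : ∀ b ∈ B, 0 < b) (hprim : IsPrimitive B)
    (h : FreeEqUnion B) : NoCoprimeScaling B := by
  rintro ⟨d, A, hd, hA2, hAinf, hcop, hAB⟩
  have hdf := notMem_of_scaling_subset hprim hd hA2 hAinf.nonempty hAB
  rw [h] at hdf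
  obtain ⟨S, hS, hdS⟩ := hdf
  obtain ⟨a, ha, haL⟩ := exists_coprime_of_infinite hAinf hcop
    (finset_lcm_pos (S := S) fun c hc => hpos c (hS hc))
  refine mem_free.1 hdS _ ⟨_, hAB a ha, rfl⟩ ?_
  rw [gcd_mul_eq_of_coprime haL]
  exact Int.natCast_dvd_natCast.2 (Nat.gcd_dvd_left _ _)

theorem noCoprimeScaling_of_windowRegular (hpos : ∀ b ∈ B, 0 < b) (hprim : IsPrimitive B)
    (h : WindowRegular B) : NoCoprimeScaling B := by
  classical
  rintro ⟨d, A, hd, hA2, hAinf, hcop, hAB⟩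
  have hdf := notMem_of_scaling_subset hprim hd hA2 hAinf.nonempty hAB
  rw [← Δ_mem_window, ← h] at hdf
  obtain ⟨a₀, ha₀⟩ := hAinf.nonempty
  -- Fixing the coordinate da₀ makes every approximating integer n congruent to d modulo da₀, hence
  -- a multiple of d.
  have hS₀ : (({d * a₀} : Finset ℕ) : Set ℕ) ⊆ B := by simpa using hAB a₀ ha₀
  obtain ⟨h', hh', hh'W⟩ := mem_closure_iff.1 hdf _ (isOpen_cylinder {d * a₀} _)
    (mem_cylinder_self _ _)
  obtain ⟨_, hx, n, rfl⟩ := denseRange_Δ.inter_open_nonempty _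
    ((isOpen_cylinder {d * a₀} (Δ B d)).inter isOpen_interior) ⟨h', hh', hh'W⟩
  obtain ⟨S, hS, hnS⟩ := Δ_mem_interior_window.1 hx.2
  have hdn : (d : ℤ) ∣ n := by
    have h1 := (Δ_mem_cylinder_Δ hS₀).1 hx.1
    rw [Finset.lcm_singleton] at h1
    have h2 : (d : ℤ) ∣ d - n := by
      refine dvd_trans ?_ h1
      simp
    exact (dvd_sub_self_left).1 h2
  obtain ⟨a, ha, haL⟩ := exists_coprime_of_infinite hAinf hcop
    (finset_lcm_pos (S := S) fun c hc => hpos c (hS hc))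
  refine mem_free.1 hnS _ ⟨_, hAB a ha, rfl⟩ ?_
  rw [gcd_mul_eq_of_coprime haL]
  exact (Int.natCast_dvd_natCast.2 (Nat.gcd_dvd_left _ _)).trans hdn

/-- If a cylinder around h ∈ W contained no free integer, a whole progression would consist of
multiples of B. Tautness then gives a single b dividing it, so h_b = 0. -/
theorem IsTaut.closure_range_Δ_inter_window (hpos : ∀ b ∈ B, 0 < b) (hT : IsTaut B) :
    closure (range (Δ B) ∩ window B) = window B := by
  classical
  refine subset_antisymm (closure_minimal inter_subset_right isClosed_window) fun h hh => ?_
  rw [mem_closure_iff_nhds]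
  intro U hU
  obtain ⟨S, hS, hSU⟩ := exists_cylinder_subset hU
  obtain ⟨n, hn⟩ := exists_Δ_mem_cylinder S h
  by_contra hcon
  have hL := finset_lcm_pos (S := S) fun c hc => hpos c (hS hc)
  have hmul : ∀ k : ℤ, n + (S.lcm id : ℕ) * k ∈ multiples B := by
    intro k
    by_contra hk
    refine hcon ⟨Δ B (n + (S.lcm id : ℕ) * k), hSU ?_, ⟨_, rfl⟩, Δ_mem_window.2 hk⟩
    have h1 : Δ B (n + (S.lcm id : ℕ) * k) ∈ cylinder S (Δ B n) := by
      rw [Δ_mem_cylinder_Δ hS, sub_add_cancel_left, dvd_neg]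
      exact dvd_mul_right _ _
    exact fun b hb => (h1 b hb).trans (hn b hb)
  obtain ⟨b, hb, hbL, hbn⟩ := hT.exists_dvd_of_progression hpos hL hmul
  -- The divisor b of lcm(S) need not belong to S, so its coordinate is fixed as well.
  obtain ⟨m, hm⟩ := exists_Δ_mem_cylinder (insert b S) h
  have hmn : ((S.lcm id : ℕ) : ℤ) ∣ n - m := by
    rw [← Δ_mem_cylinder_Δ hS]
    intro c hc
    rw [hm c (Finset.mem_insert_of_mem hc), hn c hc]
  have hbm : (b : ℤ) ∣ m := by
    have := dvd_sub hbn ((Int.natCast_dvd_natCast.2 hbL).trans hmn)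
    rwa [sub_sub_cancel] at this
  refine hh ⟨b, hb⟩ ?_
  rw [← hm ⟨b, hb⟩ (Finset.mem_insert_self _ _), Δ_apply, ZMod.intCast_zmod_eq_zero_iff_dvd]
  exact hbm

theorem windowRegular_of_forall (hd : closure (range (Δ B) ∩ window B) = window B)
    (h : ∀ n : ℤ, Δ B n ∈ window B → Δ B n ∈ closure (interior (window B))) :
    WindowRegular B := by
  refine subset_antisymm (closure_minimal interior_subset isClosed_window) ?_
  conv_lhs => rw [← hd]
  refine closure_minimal ?_ isClosed_closure
  rintro _ ⟨⟨n, rfl⟩, hn⟩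
  exact h n hn

/-! ### Orbit closures and minimal sets -/

theorem self_mem_orbitClosure (x : ℤ → Fin 2) : x ∈ orbitClosure x :=
  subset_closure ⟨0, by funext m; simp [shift]⟩

theorem orbitClosure_subset {x : ℤ → Fin 2} {N : Set (ℤ → Fin 2)} (hN : IsClosed N)
    (hinv : ∀ n : ℤ, MapsTo (shift n) N N) (hx : x ∈ N) : orbitClosure x ⊆ N := by
  refine closure_minimal ?_ hN
  rintro _ ⟨n, rfl⟩
  exact hinv n hx

theorem orbitClosure_subset_orbitClosure {x y : ℤ → Fin 2} (h : y ∈ orbitClosure x) :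
    orbitClosure y ⊆ orbitClosure x :=
  orbitClosure_subset isClosed_closure (fun n _ hz => shift_mem_orbitClosure n hz) h

theorem isMinimalSet_orbitClosure {x : ℤ → Fin 2}
    (h : ∀ y ∈ orbitClosure x, x ∈ orbitClosure y) : IsMinimalSet (orbitClosure x) := by
  refine ⟨⟨⟨x, self_mem_orbitClosure x⟩, isClosed_closure,
    fun n _ hz => shift_mem_orbitClosure n hz⟩, fun N hN hne hcl hinv => ?_⟩
  obtain ⟨z, hz⟩ := hne
  exact hN.antisymm (orbitClosure_subset hcl hinv (orbitClosure_subset hcl hinv hz (h z (hN hz))))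

/-! ### Points of `H` that code a point of the orbit closure of `η` -/

theorem compactSpace_H (hpos : ∀ b ∈ B, 0 < b) : CompactSpace (H B) := by
  have : ∀ b : B, NeZero (b : ℕ) := fun b => ⟨(hpos b b.2).ne'⟩
  have : ∀ b : B, CompactSpace (ZMod (b : ℕ)) := fun b => Finite.compactSpace
  exact isCompact_iff_compactSpace.1
    (AddSubgroup.isClosed_topologicalClosure (diag B).range).isCompact

/-- The coordinates of `y` are those of `φ(h)`, except perhaps where the orbit of `h` hits the
boundary of the window. -/
def IsCoded (y : ℤ → Fin 2) (h : H B) : Prop :=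
  ∀ m : ℤ, (h + Δ B m ∈ interior (window B) → y m = 1) ∧ (h + Δ B m ∉ window B → y m = 0)

theorem isCoded_coding (h : H B) : IsCoded (coding B h) h := fun _ =>
  ⟨fun hm => coding_eq_one_iff.2 (interior_subset hm), coding_eq_zero_iff.2⟩

theorem add_Δ_add_Δ (h : H B) (n m : ℤ) : h + Δ B n + Δ B m = h + Δ B (m + n) := by
  rw [map_add, add_assoc, add_comm (Δ B n)]

theorem IsCoded.shift {y : ℤ → Fin 2} {h : H B} (hy : IsCoded y h) (n : ℤ) :
    IsCoded (shift n y) (h + Δ B n) := fun m => by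
  rw [add_Δ_add_Δ]
  exact hy (m + n)

theorem shift_η (n : ℤ) : shift n (η B) = coding B (Δ B n) := by
  rw [η_eq_coding, shift_coding, zero_add]

theorem isClosed_isCoded : IsClosed {p : (ℤ → Fin 2) × H B | IsCoded p.1 p.2} := by
  have hset : {p : (ℤ → Fin 2) × H B | IsCoded p.1 p.2} =
      ⋂ m : ℤ, (({p | p.2 + Δ B m ∈ (interior (window B))ᶜ} ∪ {p | p.1 m = 1}) ∩
        ({p | p.2 + Δ B m ∈ window B} ∪ {p | p.1 m = 0})) := by
    ext p
    simp only [IsCoded, mem_ofPred_eq, mem_iInter, mem_inter_iff, mem_union, mem_compl_iff,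
      imp_iff_not_or, not_not]
  rw [hset]
  refine isClosed_iInter fun m => ?_
  have hadd : Continuous fun p : (ℤ → Fin 2) × H B => p.2 + Δ B m := by fun_prop
  have hev : Continuous fun p : (ℤ → Fin 2) × H B => p.1 m := by fun_prop
  exact ((isOpen_interior.isClosed_compl.preimage hadd).union
    ((isClosed_discrete {(1 : Fin 2)}).preimage hev)).inter
    ((isClosed_window.preimage hadd).union ((isClosed_discrete {(0 : Fin 2)}).preimage hev))

/-- The relation is closed and holds for the pairs (σⁿη, Δ(n)); projection along the compact group
`H` is a closed map. -/
theorem exists_isCoded (hpos : ∀ b ∈ B, 0 < b) {y : ℤ → Fin 2} (hy : y ∈ orbitClosure (η B)) :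
    ∃ h : H B, IsCoded y h := by
  have := compactSpace_H hpos
  have hcl := isClosedMap_fst_of_compactSpace _ (isClosed_isCoded (B := B))
  have hsub := closure_minimal (s := range fun n : ℤ => shift n (η B)) (by
    rintro _ ⟨n, rfl⟩
    exact ⟨(shift n (η B), Δ B n), by rw [mem_ofPred_eq, shift_η]; exact isCoded_coding _, rfl⟩) hcl
  obtain ⟨p, hp, rfl⟩ := hsub hy
  exact ⟨p.2, hp⟩

/-- The orbit of `h` does not hit the boundary of the window. -/
def OrbitAvoidsBoundary (h : H B) : Prop :=
  ∀ m : ℤ, h + Δ B m ∈ window B → h + Δ B m ∈ interior (window B)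

/-- Baire: the boundary of the closed set W is nowhere dense, and so are its countably many
translates. -/
theorem exists_orbitAvoidsBoundary (hpos : ∀ b ∈ B, 0 < b) :
    ∃ h : H B, OrbitAvoidsBoundary h := by
  have := compactSpace_H hpos
  have hd : Dense (⋂ m : ℤ, {h : H B | h + Δ B m ∈ (frontier (window B))ᶜ}) := by
    refine dense_iInter_of_isOpen (fun m => ?_) fun m => ?_
    · exact isClosed_frontier.isOpen_compl.preimage (by fun_prop)
    · have h1 : Dense (frontier (window B))ᶜ := by
        rw [← interior_eq_empty_iff_dense_compl]
        exact interior_frontier isClosed_window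
      exact h1.preimage (Homeomorph.addRight (Δ B m)).isOpenMap
  obtain ⟨h, hh⟩ := hd.nonempty
  refine ⟨h, fun m hm => ?_⟩
  by_contra hc
  exact mem_iInter.1 hh m ⟨subset_closure hm, hc⟩

theorem IsCoded.eq_coding {y : ℤ → Fin 2} {h : H B} (hy : IsCoded y h)
    (hh : OrbitAvoidsBoundary h) : y = coding B h := by
  funext m
  by_cases hm : h + Δ B m ∈ window B
  · rw [(hy m).1 (hh m hm), coding_eq_one_iff.2 hm]
  · rw [(hy m).2 hm, coding_eq_zero_iff.2 hm]

theorem OrbitAvoidsBoundary.add {h : H B} (hh : OrbitAvoidsBoundary h) (n : ℤ) :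
    OrbitAvoidsBoundary (h + Δ B n) := fun m => by
  rw [add_Δ_add_Δ]
  exact hh (m + n)

theorem denseRange_add_Δ (h : H B) : DenseRange fun n : ℤ => h + Δ B n :=
  (Homeomorph.addLeft h).surjective.denseRange.comp denseRange_Δ (Homeomorph.addLeft h).continuous

/-- Shift y along integers n with h + Δ(n) → h₀. Each h₀ + Δ(m) is in the interior or the exterior
of W, so every coordinate eventually stabilizes at that of φ(h₀). -/
theorem IsCoded.coding_mem_orbitClosure {y : ℤ → Fin 2} {h h₀ : H B} (hy : IsCoded y h)
    (hh₀ : OrbitAvoidsBoundary h₀) : coding B h₀ ∈ orbitClosure y := by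
  have hne : (comap (fun n : ℤ => h + Δ B n) (𝓝 h₀)).NeBot := by
    rw [comap_neBot_iff]
    intro t ht
    exact (denseRange_add_Δ h).exists_mem_open isOpen_interior
      ⟨h₀, mem_interior_iff_mem_nhds.2 ht⟩ |>.imp fun n hn => interior_subset hn
  refine mem_closure_of_tendsto (f := fun n : ℤ => BFree.shift n y)
    (b := comap (fun n : ℤ => h + Δ B n) (𝓝 h₀)) ?_ (Eventually.of_forall fun n => ⟨n, rfl⟩)
  rw [tendsto_pi_nhds]
  intro m
  have htend : Tendsto (fun n : ℤ => h + Δ B n + Δ B m) (comap (fun n : ℤ => h + Δ B n) (𝓝 h₀))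
      (𝓝 (h₀ + Δ B m)) :=
    ((continuous_add_const (Δ B m)).tendsto h₀).comp tendsto_comap
  have key : ∀ᶠ n : ℤ in comap (fun n : ℤ => h + Δ B n) (𝓝 h₀),
      BFree.shift n y m = coding B h₀ m := by
    by_cases hm : h₀ + Δ B m ∈ window B
    · filter_upwards [htend.eventually (isOpen_interior.mem_nhds (hh₀ m hm))] with n hn
      rw [(hy.shift n m).1 hn, coding_eq_one_iff.2 hm]
    · filter_upwards [htend.eventually (isClosed_window.isOpen_compl.mem_nhds hm)] with n hn
      rw [(hy.shift n m).2 hn, coding_eq_zero_iff.2 hm]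
  exact tendsto_const_nhds.congr' (key.mono fun _ h => h.symm)

theorem coding_mem_orbitClosure_of_mem (hpos : ∀ b ∈ B, 0 < b) {h₀ : H B}
    (hh₀ : OrbitAvoidsBoundary h₀) {y : ℤ → Fin 2} (hy : y ∈ orbitClosure (η B)) :
    coding B h₀ ∈ orbitClosure y := by
  obtain ⟨h, hyh⟩ := exists_isCoded hpos hy
  exact hyh.coding_mem_orbitClosure hh₀

/-- The orbit closure of `φ(h₀)`, for `h₀` whose orbit avoids the boundary of the window, is the
unique minimal subset of the orbit closure of `η`. -/
theorem orbitClosure_coding_minimal (hpos : ∀ b ∈ B, 0 < b) {h₀ : H B}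
    (hh₀ : OrbitAvoidsBoundary h₀) :
    orbitClosure (coding B h₀) ⊆ orbitClosure (η B) ∧ IsMinimalSet (orbitClosure (coding B h₀)) ∧
      ∀ M' ⊆ orbitClosure (η B), IsMinimalSet M' → M' = orbitClosure (coding B h₀) := by
  have hsub := orbitClosure_subset_orbitClosure
    (coding_mem_orbitClosure_of_mem hpos hh₀ (self_mem_orbitClosure (η B)))
  have hmin : IsMinimalSet (orbitClosure (coding B h₀)) :=
    isMinimalSet_orbitClosure fun y hy => coding_mem_orbitClosure_of_mem hpos hh₀ (hsub hy)
  refine ⟨hsub, hmin, fun M' hM' hminM' => ?_⟩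
  obtain ⟨⟨⟨z, hz⟩, hcl, hinv⟩, hM'min⟩ := hminM'
  have hle : orbitClosure (coding B h₀) ⊆ M' := orbitClosure_subset hcl hinv
    (orbitClosure_subset hcl hinv hz (coding_mem_orbitClosure_of_mem hpos hh₀ (hM' hz)))
  exact (hM'min _ hle hmin.1.1 hmin.1.2.1 hmin.1.2.2).symm

theorem nontrivial_orbitClosure_η (hne : B.Nonempty) (h1 : 1 ∉ B) :
    (orbitClosure (η B)).Nontrivial := by
  refine ⟨η B, self_mem_orbitClosure _, shift 1 (η B),
    shift_mem_orbitClosure 1 (self_mem_orbitClosure _), fun h => ?_⟩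
  have h0 := congrFun h 0
  simp only [shift, zero_add, η_zero hne, η_one h1] at h0
  exact absurd h0 (by simp)

/-! ### The maximal equicontinuous factor map -/

/-- If n ≡ -g_b mod b, no n + bj can be free, since adding g would kill its coordinate at b.
Tautness and primitivity then give b ∣ n. -/
theorem eq_zero_of_window_add_subset (hpos : ∀ b ∈ B, 0 < b) (hprim : IsPrimitive B)
    (hT : IsTaut B) {g : H B} (hg : ∀ k ∈ window B, k + g ∈ window B) : g = 0 := by
  refine Subtype.ext (funext fun b => ?_)
  obtain ⟨n, hn⟩ := exists_Δ_mem_cylinder {(b : ℕ)} (-g)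
  have hnb : ((n : ℤ) : ZMod (b : ℕ)) = -(g : ∀ b : B, ZMod (b : ℕ)) b :=
    hn b (Finset.mem_singleton_self _)
  have hmul : ∀ j : ℤ, n + (b : ℕ) * j ∈ multiples B := by
    intro j
    by_contra hj
    refine hg _ (Δ_mem_window.2 hj) b ?_
    change ((n + (b : ℕ) * j : ℤ) : ZMod (b : ℕ)) + (g : ∀ b : B, ZMod (b : ℕ)) b = 0
    push_cast
    rw [hnb, ZMod.natCast_self, zero_mul, add_zero, neg_add_cancel]
  obtain ⟨c, hc, hcb, hcn⟩ := hT.exists_dvd_of_progression hpos (hpos b b.2) hmul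
  rw [hprim c hc b b.2 hcb, ← ZMod.intCast_zmod_eq_zero_iff_dvd, hnb, neg_eq_zero] at hcn
  exact hcn

theorem IsCoded.unique (hpos : ∀ b ∈ B, 0 < b) (hprim : IsPrimitive B) (hW : WindowRegular B)
    (hT : IsTaut B) {y : ℤ → Fin 2} {h h' : H B} (hy : IsCoded y h) (hy' : IsCoded y h') :
    h = h' := by
  have hcont : Continuous fun k : H B => k + (h' - h) := by fun_prop
  -- The orbit of h is dense; where it meets the interior of W, y is 1, so the corresponding point
  -- of the orbit of h' cannot lie outside W.
  have hint : interior (window B) ⊆ (fun k : H B => k + (h' - h)) ⁻¹' window B := by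
    intro k hk
    by_contra hc
    obtain ⟨m, hm1, hm2⟩ := (denseRange_add_Δ h).exists_mem_open
      (isOpen_interior.inter (isClosed_window.isOpen_compl.preimage hcont)) ⟨k, hk, hc⟩
    have h0 : h + Δ B m + (h' - h) = h' + Δ B m := by abel
    rw [mem_preimage, h0] at hm2
    have h1 := (hy m).1 hm1
    rw [(hy' m).2 hm2] at h1
    exact absurd h1 (by simp)
  have hsub := closure_minimal hint (isClosed_window.preimage hcont)
  rw [hW] at hsub
  have := eq_zero_of_window_add_subset hpos hprim hT (g := h' - h) hsub
  exact (sub_eq_zero.1 this).symm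

theorem isAlmostOneOneExtension_of_windowRegular (hpos : ∀ b ∈ B, 0 < b) (hprim : IsPrimitive B)
    (hW : WindowRegular B) (hT : IsTaut B) (h0 : OrbitAvoidsBoundary (0 : H B)) :
    IsAlmostOneOneExtension B (η B) := by
  have := compactSpace_H hpos
  have : CompactSpace (orbitClosure (η B)) :=
    isCompact_iff_compactSpace.1 (isClosed_closure (s := range fun n => shift n (η B))).isCompact
  choose π hπ using fun y : orbitClosure (η B) => exists_isCoded hpos y.2
  have huniq : ∀ (y : orbitClosure (η B)) (h : H B), IsCoded (y : ℤ → Fin 2) h → π y = h :=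
    fun y h hy => (hπ y).unique hpos hprim hW hT hy
  -- By uniqueness the graph of π is the closed coding relation, so preimages of closed sets are
  -- projections of closed sets along the compact `H`.
  have hcont : Continuous π := by
    rw [continuous_iff_isClosed]
    intro F hF
    have hcl := isClosedMap_fst_of_compactSpace _
      ((isClosed_isCoded (B := B)).inter (hF.preimage continuous_snd))
    have heq : π ⁻¹' F = Subtype.val ⁻¹' (Prod.fst ''
        ({p : (ℤ → Fin 2) × H B | IsCoded p.1 p.2} ∩ Prod.snd ⁻¹' F)) := by
      ext y
      constructor
      · intro hy
        exact ⟨(y, π y), ⟨hπ y, hy⟩, rfl⟩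
      · rintro ⟨⟨y', h⟩, ⟨hc, hF'⟩, rfl⟩
        rw [mem_preimage, huniq y h hc]
        exact hF'
    rw [heq]
    exact hcl.preimage continuous_subtype_val
  have hmem : ∀ n : ℤ, shift n (η B) ∈ orbitClosure (η B) := fun n =>
    shift_mem_orbitClosure n (self_mem_orbitClosure _)
  have hπΔ : ∀ n : ℤ, π ⟨shift n (η B), hmem n⟩ = Δ B n := fun n => huniq _ _ (by
    change IsCoded (shift n (η B)) _
    rw [shift_η]
    exact isCoded_coding _)
  refine ⟨π, hcont, ?_, fun y => huniq _ _ ((hπ y).shift 1), ?_⟩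
  · rw [← range_eq_univ, ← univ_subset_iff, ← (denseRange_Δ (B := B)).closure_range]
    refine closure_minimal ?_ (isCompact_range hcont).isClosed
    rintro _ ⟨n, rfl⟩
    exact ⟨_, hπΔ n⟩
  -- The singleton fibres found are those of σⁿη: the orbit of Δ(n) avoids the boundary, so Δ(n)
  -- codes only one sequence.
  · rw [Subtype.dense_iff]
    refine closure_mono ?_
    rintro _ ⟨n, rfl⟩
    refine ⟨⟨shift n (η B), hmem n⟩, fun z hz => ?_, rfl⟩
    have hav : OrbitAvoidsBoundary (Δ B n) := by simpa using h0.add n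
    have hzc := hπ z
    rw [hz, hπΔ n] at hzc
    refine Subtype.ext ?_
    exact (hzc.eq_coding hav).trans (shift_η n).symm

/-! ### Minimality implies regularity of the window -/

/-- For φ(h₀) itself the ones occur at interior visits. Replacing the interior by its closure makes
the condition closed, so it survives limits. -/
theorem exists_add_Δ_mem_closure_interior (hpos : ∀ b ∈ B, 0 < b) {h₀ : H B}
    (hh₀ : OrbitAvoidsBoundary h₀) {y : ℤ → Fin 2} (hy : y ∈ orbitClosure (coding B h₀)) :
    ∃ h : H B, ∀ m : ℤ, y m = 1 → h + Δ B m ∈ closure (interior (window B)) := by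
  have := compactSpace_H hpos
  have hK : IsClosed {p : (ℤ → Fin 2) × H B |
      ∀ m : ℤ, p.1 m = 1 → p.2 + Δ B m ∈ closure (interior (window B))} := by
    simp only [ofPred_forall]
    refine isClosed_iInter fun m => ?_
    have hadd : Continuous fun p : (ℤ → Fin 2) × H B => p.2 + Δ B m := by fun_prop
    have hev : Continuous fun p : (ℤ → Fin 2) × H B => p.1 m := by fun_prop
    exact isClosed_imp ((isOpen_discrete {(1 : Fin 2)}).preimage hev)
      (isClosed_closure.preimage hadd)
  have hsub := closure_minimal (s := range fun n : ℤ => shift n (coding B h₀)) (by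
    rintro _ ⟨n, rfl⟩
    refine ⟨(shift n (coding B h₀), h₀ + Δ B n), fun m hm => ?_, rfl⟩
    rw [shift_coding, coding_eq_one_iff] at hm
    exact subset_closure (hh₀.add n m hm)) (isClosedMap_fst_of_compactSpace _ hK)
  obtain ⟨p, hp, rfl⟩ := hsub hy
  exact ⟨p.2, hp⟩

theorem windowRegular_of_η_mem (hpos : ∀ b ∈ B, 0 < b)
    (hd : closure (range (Δ B) ∩ window B) = window B) {h₀ : H B} (hh₀ : OrbitAvoidsBoundary h₀)
    (hη : η B ∈ orbitClosure (coding B h₀)) : WindowRegular B := by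
  obtain ⟨h, hh⟩ := exists_add_Δ_mem_closure_interior hpos hh₀ hη
  have hcl : closure (interior (window B)) ⊆ window B :=
    closure_minimal interior_subset isClosed_window
  -- The hypothesis gives this for w = Δ(n) ∈ W, and such points are dense in W.
  have hstep : ∀ w ∈ window B, w + h ∈ closure (interior (window B)) := by
    have hcont : Continuous fun w : H B => w + h := by fun_prop
    have hsub : window B ⊆ (fun w : H B => w + h) ⁻¹' closure (interior (window B)) := by
      conv_lhs => rw [← hd]
      refine closure_minimal ?_ (isClosed_closure.preimage hcont)
      rintro _ ⟨⟨n, rfl⟩, hn⟩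
      rw [mem_preimage, add_comm]
      exact hh n (η_eq_one_iff.2 (Δ_mem_window.1 hn))
    exact hsub
  have hiter : ∀ (n : ℕ), ∀ w ∈ window B, w + (n + 1) • h ∈ closure (interior (window B)) := by
    intro n
    induction n with
    | zero => simpa using hstep
    | succ n ih =>
      intro w hw
      rw [succ_nsmul, ← add_assoc]
      exact hstep _ (hcl (ih w hw))
  refine hcl.antisymm fun w hw => ?_
  rw [← closure_closure, mem_closure_iff_nhds]
  intro U hU
  obtain ⟨S, hS, hSU⟩ := exists_cylinder_subset hU
  have hL := finset_lcm_pos (S := S) fun c hc => hpos c (hS hc)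
  -- The multiple lcm(S)·h vanishes in every coordinate from S, so iterated translation by h returns
  -- to the given neighbourhood of w.
  refine ⟨w + (S.lcm id) • h, hSU fun b hb => ?_, ?_⟩
  · have hdvd : (b : ℕ) ∣ S.lcm id := Finset.dvd_lcm (f := id) hb
    change (w : ∀ b : B, ZMod (b : ℕ)) b + (S.lcm id) • (h : ∀ b : B, ZMod (b : ℕ)) b = _
    rw [nsmul_eq_mul, (ZMod.natCast_eq_zero_iff _ _).2 hdvd, zero_mul, add_zero]
  · obtain ⟨k, hk⟩ := Nat.exists_eq_succ_of_ne_zero hL.ne'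
    rw [hk]
    exact hiter k w hw

end BFree

end

/-! ### Assembly of the equivalences -/

theorem mainTheorem2 (B : Set ℕ) (hpos : ∀ b ∈ B, 0 < b) (hne : B.Nonempty) (hone : B ≠ {1})
    (hprim : BFree.IsPrimitive B) :
    BFree.η B = BFree.coding B 0 ∧
    ∃ M : Set (ℤ → Fin 2),
      -- `M` is the unique minimal subset of the orbit closure of `η`
      (M ⊆ BFree.orbitClosure (BFree.η B) ∧ BFree.IsMinimalSet M ∧
        ∀ M' ⊆ BFree.orbitClosure (BFree.η B), BFree.IsMinimalSet M' → M' = M) ∧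
      -- the six equivalent properties, which imply tautness
      ([BFree.WindowRegular B, BFree.FreeEqUnion B, BFree.GcdSetInfEmpty B,
          BFree.NoCoprimeScaling B, BFree.EtaToeplitz B, BFree.CodingContinuous B].TFAE ∧
        (BFree.WindowRegular B → BFree.IsTaut B)) ∧
      (BFree.EtaMemMinimal B M ↔ BFree.OrbitClosureMinimal B) ∧
      (BFree.WindowRegular B → BFree.MinimalAlmostOneOne B) ∧
      (BFree.MinimalAlmostOneOne B → BFree.EtaMemMinimal B M ∧ BFree.OrbitClosureMinimal B) ∧
      -- all nine properties are equivalent if `Δ(ℤ) ∩ W` is dense in `W`, in particular if `B` is taut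
      (closure (range (BFree.Δ B) ∩ BFree.window B) = BFree.window B →
        [BFree.WindowRegular B, BFree.FreeEqUnion B, BFree.GcdSetInfEmpty B,
          BFree.NoCoprimeScaling B, BFree.EtaToeplitz B, BFree.CodingContinuous B,
          BFree.EtaMemMinimal B M, BFree.OrbitClosureMinimal B,
          BFree.MinimalAlmostOneOne B].TFAE) ∧
      (BFree.IsTaut B →
        closure (range (BFree.Δ B) ∩ BFree.window B) = BFree.window B) := by
  have h1 := BFree.one_notMem_of_isPrimitive hone hprim
  have hη0 := BFree.η_ne_zero h1
  have hnt := BFree.nontrivial_orbitClosure_η hne h1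
  obtain ⟨h₀, hh₀⟩ := BFree.exists_orbitAvoidsBoundary hpos
  have hM := BFree.orbitClosure_coding_minimal hpos hh₀
  have hregular_of : BFree.FreeEqUnion B → BFree.WindowRegular B := fun h =>
    BFree.windowRegular_of_forall
      (((BFree.noCoprimeScaling_of_freeEqUnion hpos hprim h).isTaut hpos
        hprim).closure_range_Δ_inter_window hpos)
      fun n hn => subset_closure (BFree.freeEqUnion_iff.1 h n hn)
  have h14 : BFree.WindowRegular B → BFree.NoCoprimeScaling B :=
    BFree.noCoprimeScaling_of_windowRegular hpos hprim
  have h43 : BFree.NoCoprimeScaling B → BFree.GcdSetInfEmpty B :=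
    BFree.gcdSetInfEmpty_of_noCoprimeScaling hpos
  have h32 : BFree.GcdSetInfEmpty B → BFree.FreeEqUnion B :=
    BFree.freeEqUnion_of_gcdSetInfEmpty hne
  have h52 : BFree.EtaToeplitz B ↔ BFree.FreeEqUnion B := by
    rw [BFree.EtaToeplitz, and_iff_left hη0, BFree.isToeplitz_η_iff hpos]
  have h62 : BFree.CodingContinuous B ↔ BFree.FreeEqUnion B := by
    rw [BFree.CodingContinuous, ← BFree.η_eq_coding, and_iff_left hη0,
      BFree.continuousAt_coding_zero_iff]
  have h78 : BFree.EtaMemMinimal B (BFree.orbitClosure (BFree.coding B h₀)) ↔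
      BFree.OrbitClosureMinimal B := by
    constructor
    · rintro ⟨hη, -⟩
      refine ⟨?_, hnt⟩
      rw [(BFree.orbitClosure_subset_orbitClosure hη).antisymm hM.1]
      exact hM.2.1
    · rintro ⟨hmin, -⟩
      refine ⟨?_, hη0⟩
      rw [← hM.2.2 _ subset_rfl hmin]
      exact BFree.self_mem_orbitClosure _
  have h19 : BFree.WindowRegular B → BFree.MinimalAlmostOneOne B := fun h => by
    have h0 : BFree.OrbitAvoidsBoundary (0 : BFree.H B) := fun m => by
      rw [zero_add]
      exact BFree.freeEqUnion_iff.1 (h32 (h43 (h14 h))) m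
    refine ⟨?_, BFree.isAlmostOneOneExtension_of_windowRegular hpos hprim h
      ((h14 h).isTaut hpos hprim) h0⟩
    rw [BFree.η_eq_coding]
    -- Under (2) the point 0 itself avoids the boundary and can serve as h₀.
    exact (BFree.orbitClosure_coding_minimal hpos h0).2.1
  have h98 : BFree.MinimalAlmostOneOne B → BFree.OrbitClosureMinimal B := fun h => ⟨h.1, hnt⟩
  refine ⟨BFree.η_eq_coding, BFree.orbitClosure (BFree.coding B h₀), hM, ⟨?_, fun h =>
    (h14 h).isTaut hpos hprim⟩, h78, h19, fun h => ⟨h78.2 (h98 h), h98 h⟩, fun hd => ?_,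
    fun hT => hT.closure_range_Δ_inter_window hpos⟩
  · tfae_have 1 → 4 := h14
    tfae_have 4 → 3 := h43
    tfae_have 3 → 2 := h32
    tfae_have 2 → 1 := hregular_of
    tfae_have 5 ↔ 2 := h52
    tfae_have 6 ↔ 2 := h62
    tfae_finish
  · tfae_have 1 → 4 := h14
    tfae_have 4 → 3 := h43
    tfae_have 3 → 2 := h32
    tfae_have 2 → 1 := hregular_of
    tfae_have 5 ↔ 2 := h52
    tfae_have 6 ↔ 2 := h62
    tfae_have 7 ↔ 8 := h78
    tfae_have 1 → 9 := h19
    tfae_have 9 → 8 := h98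
    tfae_have 7 → 1 := fun h => BFree.windowRegular_of_η_mem hpos hd hh₀ h.1
    tfae_finish
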